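/- Let $(D,\mu)$ be a probability space and let $H$ be a reproducing kernel Hilbert space of complex-valued functions on $D$ with kernel $K$, where $K(x,\cdot)\in H$ represents the evaluation at $x$, i.e. $f(x)=\langle f,K(x,\cdot)\rangle_H$ for $f\in H$. Assume that $H$ consists of square-integrable functions, write $\|\cdot\|_2$ for the norm of $L_2(D,\mu)$, and assume that the embedding of $H$ into $L_2(D,\mu)$ is continuous, $\sup_{0\ne f\in H}\|f\|_2^2/\|f\|_H^2<\infty$, and injective, $\|f\|_2\neq 0$ for all $f\in H\setminus\{0\}$, and that the kernel has finite trace $\operatorname{Tr}(K)=\int K(x,x)\,d\mu(x)<\infty$. Let $m\ge 1$ and let $V_m\subset H$ be an $m$-dimensional subspace which contains the Riesz representer of the integral, \[ h=\int K(x,\cdot)\,d\mu(x)\in V_m . \] Let $H_m$ be the $H$-orthogonal complement of $V_m$, with the norm of $H$, let $K_m$ be its reproducing kernel, let $P_m$ be the $H$-orthogonal projection onto $V_m$, and put \[ \lambda_m=\sup_{0\ne f\in H_m}\frac{\|f\|_2^2}{\|f\|_H^2},\qquad \operatorname{Tr}(K_m)=\int K_m(x,x)\,d\mu(x),\qquad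 r=\sqrt{\frac{m-1}{n}},\qquad \tilde s=\sqrt{\frac{\operatorname{Tr}(K_m)}{n\lambda_m}}, \] where $\lambda_m=\tilde s=0$ if $V_m=H$. Then for every integer $n\ge m$ there are points $x_1,\dots,x_n\in D$ and weights $w_1,\dots,w_n>0$ such that, for all $f\in H$ and all $e=(e_1,\dots,e_n)\in\mathbb C^n$, the weighted least squares problem with the noisy data $y_i=f(x_i)+e_i$ has a unique solution \[ \tilde f=\operatorname*{arg\,min}_{g\in V_m}\sum_{i=1}^n w_i\,|y_i-g(x_i)|^2 , \] and it satisfies \[ \|f-\tilde f\|_2\le\frac{1+\tilde s}{1-r}\Bigl(2\sqrt{\lambda_m}\,\|f-P_mf\|_H+\|e\|_\infty\Bigr), \] where $\|e\|_\infty=\max_i|e_i|$. -/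

import Mathlib

open MeasureTheory

noncomputable section

namespace NoisyRecovery

/-- A subspace `U` of a reproducing kernel Hilbert space `H`, with the norm of `H`, is again a
reproducing kernel Hilbert space on the same domain. -/
instance subspaceRKHS {D H : Type*} [NormedAddCommGroup H] [InnerProductSpace ℂ H]
    [RKHS ℂ H D ℂ] (U : Submodule ℂ H) : RKHS ℂ U D ℂ where
  coeCLM := (RKHS.coeCLM ℂ : H →L[ℂ] D → ℂ).comp U.subtypeL
  coeCLM_injective := RKHS.coeCLM_injective.comp Subtype.val_injective

/-- The function that belongs to an element of a subspace is the one it has in `H`. -/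
theorem subspace_apply {D H : Type*} [NormedAddCommGroup H] [InnerProductSpace ℂ H]
    [RKHS ℂ H D ℂ] (U : Submodule ℂ H) (f : U) (x : D) : f x = (f : H) x := rfl

section Kernel

variable {D : Type*} (H : Type*) [NormedAddCommGroup H] [InnerProductSpace ℂ H]
  [CompleteSpace H] [RKHS ℂ H D ℂ]

/-- The scalar kernel `K`, normalized such that `K(x, ·)` is the element of `H` that represents
the evaluation at `x`, i.e. `f x = ⟪K(x, ·), f⟫` with Mathlib's inner product (which is linear in
the second argument). -/
def K (x y : D) : ℂ := RKHS.kerFun H x (1 : ℂ) y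

/-- The trace `Tr(K) = ∫ K(x, x) dμ(x)`; the diagonal of `K` is real and nonnegative. -/
def traceK [MeasurableSpace D] (μ : Measure D) : ℝ := ∫ x, (K H x x).re ∂μ

end Kernel

/-- The number `sup_f ‖f‖₂² / ‖f‖_H²`. The term at `f = 0` is `0`, so that the supremum is `0` if
`H = {0}`. -/
def embConst {D : Type*} (H : Type*) [NormedAddCommGroup H] [InnerProductSpace ℂ H]
    [RKHS ℂ H D ℂ] [MeasurableSpace D] (μ : Measure D) : ℝ :=
  ⨆ f : H, (lpNorm (⇑f) 2 μ) ^ 2 / ‖f‖ ^ 2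

/-- The standing assumptions on `H`: it consists of square-integrable functions, the embedding
into `L₂(μ)` is continuous and injective, and the kernel has finite trace. -/
structure Admissible {D : Type*} (H : Type*) [NormedAddCommGroup H] [InnerProductSpace ℂ H]
    [CompleteSpace H] [RKHS ℂ H D ℂ] [MeasurableSpace D] (μ : Measure D) : Prop where
  memLp : ∀ f : H, MemLp (⇑f) 2 μ
  continuous : BddAbove (Set.range fun f : H => (lpNorm (⇑f) 2 μ) ^ 2 / ‖f‖ ^ 2)
  injective : ∀ f : H, f ≠ 0 → lpNorm (⇑f) 2 μ ≠ 0
  finiteTrace : Integrable (fun x => (K H x x).re) μ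

/-- `g` is a minimizer over `V` of the weighted least squares functional
`∑ i, w i * |y i - g (x i)|²`. -/
def IsWeightedLeastSquares {D H : Type*} [NormedAddCommGroup H] [InnerProductSpace ℂ H]
    [RKHS ℂ H D ℂ] (V : Submodule ℂ H) {n : ℕ} (x : Fin n → D) (w : Fin n → ℝ)
    (y : Fin n → ℂ) (g : H) : Prop :=
  g ∈ V ∧ ∀ g' ∈ V, ∑ i, w i * ‖y i - g (x i)‖ ^ 2 ≤ ∑ i, w i * ‖y i - g' (x i)‖ ^ 2

end NoisyRecovery

end

/-! The points and weights are chosen one at a time by a barrier argument in the style of Batson,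
Spielman and Srivastava. Let `M` be the second moment operator of the sampling vectors `b x`. A
barrier is a positive invertible operator `W` whose potential tr(`M W⁻¹`) stays at most `ε`. One
step moves the upper barrier to `W + δM - w b bᴴ` and the lower one to `W - δM + w b bᴴ`. A point
`x` with weight `w` preserves the upper potential if `U x * w ≤ 1` and the lower one if `1 ≤ L x *
w` (`upper_barrier_step`, `lower_barrier_step`). Since `∫ U ≤ 1 ≤ ∫ L`, some `x` has `U x ≤ L x`,
and `w = 1 / U x` serves both (`UpperRule.exists_list`). After `n` steps, potential at most `ε`
means `M ≤ ε W`, which is a frame bound.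

The lower barrier lives on `V`. The upper one lives on `ℂ ⊕ Vᗮ`, with sampling vectors `(1, λ^(-1/2)
K_m(x, ·))`. As `h ∈ V`, functions in `Vᗮ` have mean zero, so the two summands decouple and `M ≤ 1`.
A single upper frame bound thus controls both the total weight, which governs the noise, and the
samples of `f - P_m f`.

Least squares projects the sampled data orthogonally, so the lower bound on `V` turns these two
estimates into the error bound. -/

noncomputable section

namespace NoisyRecovery

open InnerProductSpace

/-! ### Positive invertible operators and rank-one updates -/

section Operators

variable {E : Type*} [NormedAddCommGroup E] [InnerProductSpace ℂ E]

/-- The Cauchy-Schwarz inequality for the semi-inner product of a positive operator. -/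
theorem norm_inner_sq_le_of_isPositive {T : E →L[ℂ] E} (hT : T.IsPositive) (u v : E) :
    ‖inner ℂ u (T v)‖ ^ 2 ≤ (inner ℂ u (T u)).re * (inner ℂ v (T v)).re := by
  let c : PreInnerProductSpace.Core ℂ E :=
    { inner := fun x y => inner ℂ x (T y)
      conj_inner_symm := fun x y => by
        rw [inner_conj_symm, hT.inner_left_eq_inner_right]
      re_inner_nonneg := fun x => hT.re_inner_nonneg_right x
      add_left := fun x y z => inner_add_left _ _ _
      smul_left := fun x y r => inner_smul_left _ _ _ }
  have h := @InnerProductSpace.Core.inner_mul_inner_self_le ℂ E _ _ _ c u v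
  have hs : ‖inner ℂ v (T u)‖ = ‖inner ℂ u (T v)‖ := by
    rw [← hT.inner_left_eq_inner_right, norm_inner_symm]
  calc ‖inner ℂ u (T v)‖ ^ 2 = ‖inner ℂ u (T v)‖ * ‖inner ℂ v (T u)‖ := by rw [hs, sq]
    _ ≤ _ := h

theorem inner_im_eq_zero_of_isPositive {T : E →L[ℂ] E} (hT : T.IsPositive) (v : E) :
    inner ℂ v (T v) = ((inner ℂ v (T v)).re : ℂ) := by
  have h := hT.inner_nonneg_right v
  exact Complex.ext rfl (Complex.le_def.1 h).2.symm

/-- `W` is a positive operator with bounded inverse `R`. -/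
structure IsPosInv (W R : E →L[ℂ] E) : Prop where
  isPositive : W.IsPositive
  apply_inv : ∀ v, W (R v) = v
  inv_apply : ∀ v, R (W v) = v

theorem IsPosInv.inv_isPositive {W R : E →L[ℂ] E} (h : IsPosInv W R) : R.IsPositive := by
  rw [ContinuousLinearMap.isPositive_iff]
  refine ⟨fun u v => ?_, fun v => ?_⟩
  · have := h.isPositive.inner_left_eq_inner_right (R u) (R v)
    rw [h.apply_inv, h.apply_inv] at this
    exact this.symm
  · have := h.isPositive.inner_nonneg_right (R v)
    rwa [h.apply_inv] at this

theorem IsPosInv.norm_inner_sq_le {W R : E →L[ℂ] E} (h : IsPosInv W R) (u v : E) :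
    ‖inner ℂ u v‖ ^ 2 ≤ (inner ℂ u (R u)).re * (inner ℂ v (W v)).re := by
  have := norm_inner_sq_le_of_isPositive h.inv_isPositive u (W v)
  rwa [h.inv_apply, h.isPositive.inner_left_eq_inner_right] at this

theorem IsPosInv.inner_inv_pos {W R : E →L[ℂ] E} (h : IsPosInv W R) {u : E} (hu : u ≠ 0) :
    0 < (inner ℂ u (R u)).re := by
  have h1 := h.norm_inner_sq_le u u
  have h2 : 0 < ‖inner ℂ u u‖ := norm_pos_iff.2 (inner_self_ne_zero.2 hu)
  have h3 : 0 ≤ (inner ℂ u (R u)).re := h.inv_isPositive.re_inner_nonneg_right u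
  rcases h3.eq_or_lt with h4 | h4
  · rw [← h4, zero_mul] at h1
    nlinarith
  · exact h4

theorem isPositive_real_smul {T : E →L[ℂ] E} (hT : T.IsPositive) {c : ℝ} (hc : 0 ≤ c) :
    (c • T).IsPositive := by
  have h := hT.smul_of_nonneg (c := (c : ℂ)) (by exact_mod_cast hc)
  rwa [Complex.coe_smul] at h

theorem IsPosInv.smul {W R : E →L[ℂ] E} (h : IsPosInv W R) {c : ℝ} (hc : 0 < c) :
    IsPosInv (c • W) (c⁻¹ • R) := by
  refine ⟨isPositive_real_smul h.isPositive hc.le, fun v => ?_, fun v => ?_⟩ <;>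
  simp [smul_smul, hc.ne', h.apply_inv, h.inv_apply]

theorem isPosInv_one : IsPosInv (1 : E →L[ℂ] E) 1 :=
  ⟨ContinuousLinearMap.isPositive_one, fun _ => rfl, fun _ => rfl⟩

/-- Strict positivity in the C⋆-algebra of operators passes to larger operators. This supplies the
inverses of shifted barriers without any compactness or finite dimension. -/
theorem IsPosInv.exists_of_le [CompleteSpace E] {W R W' : E →L[ℂ] E} (h : IsPosInv W R)
    (hle : (W' - W).IsPositive) : ∃ R', IsPosInv W' R' := by
  have hW : IsStrictlyPositive W := by
    refine ⟨(ContinuousLinearMap.nonneg_iff_isPositive W).2 h.isPositive, ?_⟩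
    exact ⟨⟨W, R, ContinuousLinearMap.ext h.apply_inv, ContinuousLinearMap.ext h.inv_apply⟩, rfl⟩
  have hW' : IsStrictlyPositive W' := hW.of_le ((ContinuousLinearMap.le_def W W').2 hle)
  obtain ⟨u, hu⟩ := hW'.isUnit
  refine ⟨↑u⁻¹, (ContinuousLinearMap.nonneg_iff_isPositive W').1 hW'.nonneg, fun v => ?_,
    fun v => ?_⟩
  · rw [← hu]
    exact congrArg (fun T : E →L[ℂ] E => T v) u.mul_inv
  · rw [← hu]
    exact congrArg (fun T : E →L[ℂ] E => T v) u.inv_mul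

/-- The Sherman-Morrison formula. -/
theorem IsPosInv.add_rankOne {W R : E →L[ℂ] E} (h : IsPosInv W R) (u : E) {t : ℝ}
    (ht : 0 < 1 + t * (inner ℂ u (R u)).re) :
    IsPosInv (W + t • rankOne ℂ u u)
      (R - (t / (1 + t * (inner ℂ u (R u)).re)) • rankOne ℂ (R u) (R u)) := by
  have hβ := inner_im_eq_zero_of_isPositive h.inv_isPositive u
  have hsymm := h.inv_isPositive.inner_left_eq_inner_right u
  set β := (inner ℂ u (R u)).re with hβd
  set s := t / (1 + t * β) with hs
  have hst : (s : ℂ) = t - t * s * β := by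
    have : s = t - t * s * β := by
      rw [hs]; field_simp; ring
    exact_mod_cast this
  refine ⟨?_, fun v => ?_, fun v => ?_⟩
  · rw [ContinuousLinearMap.isPositive_iff_complex]
    intro v
    have h1 : inner ℂ ((W + t • rankOne ℂ u u) v) v
        = (((inner ℂ v (W v)).re + t * ‖inner ℂ u v‖ ^ 2 : ℝ) : ℂ) := by
      have h2 := inner_im_eq_zero_of_isPositive h.isPositive v
      simp only [add_apply, smul_apply, rankOne_apply,
        inner_add_left, inner_smul_left_eq_smul, inner_smul_left,
        h.isPositive.inner_left_eq_inner_right]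
      rw [h2, Complex.conj_mul', Complex.real_smul]
      push_cast [Complex.ofReal_re]
      rfl
    rw [h1]
    refine ⟨by simp only [RCLike.re_to_complex, Complex.ofReal_re], ?_⟩
    have h4 := h.norm_inner_sq_le u v
    have h5 : 0 ≤ (inner ℂ v (W v)).re := h.isPositive.re_inner_nonneg_right v
    have h6 : 0 ≤ β := h.inv_isPositive.re_inner_nonneg_right u
    simp only [Complex.ofReal_re, RCLike.re_to_complex]
    -- For `t < 0`, Cauchy-Schwarz bounds the form below by `(1 + t * β) * ⟪v, W v⟫`.
    rcases le_or_gt 0 t with h7 | h7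
    · positivity
    · nlinarith
  · simp only [add_apply, sub_apply, smul_apply, rankOne_apply, ← Complex.coe_smul, map_sub,
      map_smul, h.apply_inv, hsymm, hβ]
    match_scalars
    · simp
    · linear_combination (-inner ℂ u (R v)) * hst
  · simp only [add_apply, sub_apply, smul_apply, rankOne_apply, ← Complex.coe_smul, map_add,
      map_smul, h.inv_apply, hsymm, hβ]
    match_scalars
    · simp
    · linear_combination (-inner ℂ u v) * hst

end Operators

/-! ### Second moment operators and the trace potential -/

section Moments

variable {D : Type*} [MeasurableSpace D] {μ : Measure D}
  {E : Type*} [NormedAddCommGroup E] [InnerProductSpace ℂ E] {b : D → E}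

/-- The second moment operator `v ↦ ∫ ⟪b x, v⟫ • b x ∂μ` of a square-integrable map `b`. -/
def momentOp (μ : Measure D) (b : D → E) : E →L[ℂ] E := ∫ x, rankOne ℂ (b x) (b x) ∂μ

/-- The real part of the trace of `T` times the second moment operator of `b`. -/
def momentTr (μ : Measure D) (b : D → E) (T : E →L[ℂ] E) : ℝ :=
  ∫ x, (inner ℂ (b x) (T (b x))).re ∂μ

theorem integrable_norm_sq {F : Type*} [NormedAddCommGroup F] {b : D → F} (hb : MemLp b 2 μ) : Integrable (fun x => ‖b x‖ ^ 2) μ :=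
  hb.integrable_norm_pow (by norm_num)

theorem integrable_rankOne (hb : MemLp b 2 μ) :
    Integrable (fun x => rankOne ℂ (b x) (b x)) μ := by
  refine (integrable_norm_sq hb).mono' ?_ (ae_of_all _ fun x => ?_)
  · have hc : Continuous fun u : E => rankOne ℂ u u :=
      (ContinuousLinearMap.smulRightL ℂ E E).continuous₂.comp
        ((innerSL ℂ : E →L⋆[ℂ] E →L[ℂ] ℂ).continuous.prodMk continuous_id)
    exact hc.comp_aestronglyMeasurable hb.1
  · rw [norm_rankOne, sq]

theorem integrable_inner_apply (hb : MemLp b 2 μ) (T : E →L[ℂ] E) :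
    Integrable (fun x => (inner ℂ (b x) (T (b x))).re) μ := by
  refine ((integrable_norm_sq hb).const_mul ‖T‖).mono' ?_ (ae_of_all _ fun x => ?_)
  · exact Complex.continuous_re.comp_aestronglyMeasurable
      (hb.1.inner (T.continuous.comp_aestronglyMeasurable hb.1))
  · calc ‖(inner ℂ (b x) (T (b x))).re‖ ≤ ‖inner ℂ (b x) (T (b x))‖ := Complex.abs_re_le_norm _
      _ ≤ ‖b x‖ * ‖T (b x)‖ := norm_inner_le_norm _ _
      _ ≤ ‖b x‖ * (‖T‖ * ‖b x‖) := by gcongr; exact T.le_opNorm _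
      _ = ‖T‖ * ‖b x‖ ^ 2 := by ring

theorem integrable_norm_inner_sq (hb : MemLp b 2 μ) (v : E) :
    Integrable (fun x => ‖inner ℂ (b x) v‖ ^ 2) μ :=
  integrable_norm_sq (hb.inner_const v)

theorem momentTr_add (hb : MemLp b 2 μ) (S T : E →L[ℂ] E) :
    momentTr μ b (S + T) = momentTr μ b S + momentTr μ b T := by
  simp only [momentTr, add_apply, inner_add_right, Complex.add_re]
  exact integral_add (integrable_inner_apply hb S) (integrable_inner_apply hb T)

theorem momentTr_smul (c : ℝ) (T : E →L[ℂ] E) :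
    momentTr μ b (c • T) = c * momentTr μ b T := by
  simp only [momentTr, smul_apply, inner_smul_right_eq_smul, Complex.smul_re, smul_eq_mul]
  exact integral_const_mul _ _

theorem momentTr_sub (hb : MemLp b 2 μ) (S T : E →L[ℂ] E) :
    momentTr μ b (S - T) = momentTr μ b S - momentTr μ b T := by
  simp only [momentTr, sub_apply, inner_sub_right, Complex.sub_re]
  exact integral_sub (integrable_inner_apply hb S) (integrable_inner_apply hb T)

theorem momentTr_le_of_forall (hb : MemLp b 2 μ) {T : E →L[ℂ] E} {c : ℝ}
    (hT : ∀ v, (inner ℂ v (T v)).re ≤ c * ‖v‖ ^ 2) :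
    momentTr μ b T ≤ c * ∫ x, ‖b x‖ ^ 2 ∂μ := by
  rw [← integral_const_mul]
  exact integral_mono (integrable_inner_apply hb T) ((integrable_norm_sq hb).const_mul c)
    fun x => hT (b x)

variable [CompleteSpace E]

theorem inner_momentOp_eq_integral (hb : MemLp b 2 μ) (u v : E) :
    inner ℂ u (momentOp μ b v) = ∫ x, inner ℂ u (b x) * inner ℂ (b x) v ∂μ := by
  have h1 : momentOp μ b v = ∫ x, inner ℂ (b x) v • b x ∂μ :=
    ContinuousLinearMap.integral_apply (integrable_rankOne hb) v
  have h2 : Integrable (fun x => inner ℂ (b x) v • b x) μ :=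
    (integrable_rankOne hb).apply_continuousLinearMap v
  rw [h1, ← integral_inner h2]
  simp only [inner_smul_right, mul_comm]

theorem inner_momentOp_self (hb : MemLp b 2 μ) (v : E) :
    inner ℂ v (momentOp μ b v) = ((∫ x, ‖inner ℂ (b x) v‖ ^ 2 ∂μ : ℝ) : ℂ) := by
  rw [inner_momentOp_eq_integral hb, ← integral_complex_ofReal]
  refine integral_congr_ae (ae_of_all _ fun x => ?_)
  simp only
  rw [← inner_conj_symm v (b x), Complex.conj_mul']
  norm_cast

theorem inner_momentOp_self_re (hb : MemLp b 2 μ) (v : E) :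
    (inner ℂ v (momentOp μ b v)).re = ∫ x, ‖inner ℂ (b x) v‖ ^ 2 ∂μ := by
  rw [inner_momentOp_self hb, Complex.ofReal_re]

theorem momentOp_isPositive (hb : MemLp b 2 μ) : (momentOp μ b).IsPositive := by
  rw [ContinuousLinearMap.isPositive_iff_complex]
  intro v
  rw [← inner_conj_symm, inner_momentOp_self hb]
  simp only [Complex.conj_ofReal, RCLike.re_to_complex, Complex.ofReal_re, true_and]
  positivity

theorem momentTr_rankOne (hb : MemLp b 2 μ) (u : E) :
    momentTr μ b (rankOne ℂ u u) = (inner ℂ u (momentOp μ b u)).re := by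
  rw [inner_momentOp_self_re hb, momentTr]
  refine integral_congr_ae (ae_of_all _ fun x => ?_)
  simp only [rankOne_apply, inner_smul_right]
  rw [← inner_conj_symm u (b x), Complex.conj_mul']
  norm_cast

/-- An operator whose inverse has small potential dominates the second moment operator. -/
theorem IsPosInv.inner_momentOp_le (hb : MemLp b 2 μ) {W R : E →L[ℂ] E} (h : IsPosInv W R)
    {ε : ℝ} (hε : momentTr μ b R ≤ ε) (v : E) :
    (inner ℂ v (momentOp μ b v)).re ≤ ε * (inner ℂ v (W v)).re := by
  have h0 : 0 ≤ (inner ℂ v (W v)).re := h.isPositive.re_inner_nonneg_right v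
  rw [inner_momentOp_self_re hb]
  calc ∫ x, ‖inner ℂ (b x) v‖ ^ 2 ∂μ
      ≤ ∫ x, (inner ℂ (b x) (R (b x))).re * (inner ℂ v (W v)).re ∂μ :=
        integral_mono (integrable_norm_inner_sq hb v)
          ((integrable_inner_apply hb R).mul_const _) fun x => h.norm_inner_sq_le (b x) v
    _ = momentTr μ b R * (inner ℂ v (W v)).re := integral_mul_const _ _
    _ ≤ _ := by gcongr

end Moments

/-! ### Change of the potential under a shift by the moment operator -/

section Resolvent

variable {D : Type*} [MeasurableSpace D] {μ : Measure D}
  {E : Type*} [NormedAddCommGroup E] [InnerProductSpace ℂ E] {b : D → E}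
  {W R W₁ R₁ : E →L[ℂ] E} {t : ℝ}

theorem resolvent_sub (h : IsPosInv W R) (h₁ : IsPosInv W₁ R₁) {M : E →L[ℂ] E}
    (hW : W₁ = W + t • M) (v : E) : R v - R₁ v = t • R₁ (M (R v)) := by
  have : W (R v) + t • M (R v) = W₁ (R v) := by simp [hW]
  rw [h.apply_inv] at this
  have h2 := congrArg R₁ this
  rw [h₁.inv_apply, map_add, ← Complex.coe_smul, map_smul, Complex.coe_smul] at h2
  exact sub_eq_iff_eq_add'.2 h2.symm

theorem resolvent_sub' (h : IsPosInv W R) (h₁ : IsPosInv W₁ R₁) {M : E →L[ℂ] E}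
    (hW : W₁ = W + t • M) (v : E) : R v - R₁ v = t • R (M (R₁ v)) := by
  have := resolvent_sub (t := -t) h₁ h (M := M) (by rw [hW]; module) v
  rw [neg_smul] at this
  rw [← neg_sub, this, neg_neg]

/-- First-order decay of the potential `momentTr μ b` of the inverse along the moment operator. -/
def resolventDecay (μ : Measure D) (b : D → E) (R : E →L[ℂ] E) (z : D) : ℝ :=
  (inner ℂ (R (b z)) (momentOp μ b (R (b z)))).re

theorem resolventDecay_eq (h₁ : IsPosInv W₁ R₁) (z : D) :
    resolventDecay μ b R₁ z =
      (inner ℂ (b z) ((R₁ ∘L momentOp μ b ∘L R₁) (b z))).re := by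
  simp [resolventDecay, h₁.inv_isPositive.inner_left_eq_inner_right]

theorem integrable_resolventDecay (hb : MemLp b 2 μ) (h₁ : IsPosInv W₁ R₁) :
    Integrable (resolventDecay μ b R₁) μ := by
  simp only [funext (resolventDecay_eq (μ := μ) (b := b) h₁)]
  exact integrable_inner_apply hb _

/-- Second-order term of the expansion of the potential. -/
def resolventConvexity (μ : Measure D) (b : D → E) (R R₁ : E →L[ℂ] E) : ℝ :=
  momentTr μ b (R₁ ∘L momentOp μ b ∘L R ∘L momentOp μ b ∘L R₁)

/-- Inserting one form of the resolvent identity into the other gives the exact expansion `R - R₁ =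
t R₁MR₁ + t² R₁MRMR₁`. -/
theorem momentTr_sub_eq (hb : MemLp b 2 μ) (h : IsPosInv W R) (h₁ : IsPosInv W₁ R₁)
    (hW : W₁ = W + t • momentOp μ b) :
    momentTr μ b R - momentTr μ b R₁ =
      t * ∫ z, resolventDecay μ b R₁ z ∂μ + t ^ 2 * resolventConvexity μ b R R₁ := by
  have h2 : R - R₁ = t • (R₁ ∘L momentOp μ b ∘L R₁)
      + t ^ 2 • (R₁ ∘L momentOp μ b ∘L R ∘L momentOp μ b ∘L R₁) := by
    ext v
    have e1 := resolvent_sub h h₁ hW v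
    have e2 := resolvent_sub' h h₁ hW v
    have e3 : R v = R₁ v + t • R (momentOp μ b (R₁ v)) := by rw [← e2]; abel
    rw [sub_apply, e1, e3]
    simp only [← Complex.coe_smul, map_add, map_smul, add_apply, smul_apply,
      ContinuousLinearMap.comp_apply, smul_add, smul_smul]
    push_cast
    rw [sq]
  rw [← momentTr_sub hb, h2, momentTr_add hb, momentTr_smul, momentTr_smul]
  simp only [funext (resolventDecay_eq (μ := μ) (b := b) h₁)]
  rfl

variable [CompleteSpace E]

theorem resolventDecay_nonneg (hb : MemLp b 2 μ) (z : D) : 0 ≤ resolventDecay μ b R₁ z :=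
  (momentOp_isPositive hb).re_inner_nonneg_right _

theorem resolventConvexity_nonneg (hb : MemLp b 2 μ) (h : IsPosInv W R) (h₁ : IsPosInv W₁ R₁) :
    0 ≤ resolventConvexity μ b R R₁ := by
  refine integral_nonneg fun x => ?_
  simp only [ContinuousLinearMap.comp_apply]
  rw [← h₁.inv_isPositive.inner_left_eq_inner_right,
    ← (momentOp_isPositive hb).inner_left_eq_inner_right]
  exact h.inv_isPositive.re_inner_nonneg_right _

/-- Cauchy-Schwarz for the trace form weighted by `R`, obtained from the discriminant of a
nonnegative quadratic. The lower barrier needs it to absorb the growth of its potential under the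
shift. -/
theorem momentTr_sub_sq_le (hb : MemLp b 2 μ) (h : IsPosInv W R) (h₁ : IsPosInv W₁ R₁)
    (hW : W₁ = W + t • momentOp μ b) :
    (momentTr μ b R - momentTr μ b R₁) ^ 2 ≤
      t ^ 2 * (momentTr μ b R * resolventConvexity μ b R R₁) := by
  set X := momentTr μ b (R₁ ∘L momentOp μ b ∘L R) with hX
  have e1 : momentTr μ b R - momentTr μ b R₁ = t * X := by
    rw [← momentTr_sub hb, hX, ← momentTr_smul]
    congr 1
    ext v
    exact resolvent_sub h h₁ hW v
  have key : ∀ s : ℝ, 0 ≤ resolventConvexity μ b R R₁ * (s * s) + (-2 * X) * s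
      + momentTr μ b R := by
    -- The quadratic at `s` is the integral of `⟪a - s v, R (a - s v)⟫` with `a = b x` and `v = M R₁
    -- a`.
    intro s
    set T : E →L[ℂ] E := R - (2 * s) • (R₁ ∘L momentOp μ b ∘L R)
      + s ^ 2 • (R₁ ∘L momentOp μ b ∘L R ∘L momentOp μ b ∘L R₁) with hT
    have hTr : momentTr μ b T = resolventConvexity μ b R R₁ * (s * s) + (-2 * X) * s
      + momentTr μ b R := by
      rw [hT, momentTr_add hb, momentTr_sub hb, momentTr_smul, momentTr_smul, ← hX,
        resolventConvexity]
      ring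
    rw [← hTr]
    refine integral_nonneg fun x => ?_
    set a := b x
    set v := momentOp μ b (R₁ a) with hv
    have hpos : 0 ≤ (inner ℂ (a - s • v) (R (a - s • v))).re :=
      h.inv_isPositive.re_inner_nonneg_right _
    have s1 : ∀ u, inner ℂ a (R₁ (momentOp μ b u)) = inner ℂ v u := fun u => by
      rw [← h₁.inv_isPositive.inner_left_eq_inner_right,
        ← (momentOp_isPositive hb).inner_left_eq_inner_right]
    have s2 : (inner ℂ a (R v)).re = (inner ℂ v (R a)).re := by
      rw [← h.inv_isPositive.inner_left_eq_inner_right, ← inner_conj_symm, Complex.conj_re]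
    have : (inner ℂ a (T a)).re = (inner ℂ (a - s • v) (R (a - s • v))).re := by
      simp only [hT, add_apply, sub_apply, smul_apply, ContinuousLinearMap.comp_apply,
        inner_add_right, inner_sub_right, inner_smul_right_eq_smul, s1, ← hv,
        ← Complex.coe_smul, map_sub, map_smul, inner_sub_left, inner_smul_left,
        Complex.conj_ofReal, smul_eq_mul, Complex.add_re, Complex.sub_re, Complex.re_ofReal_mul, s2]
      ring
    exact hpos.trans_eq this.symm
  have hd := discrim_le_zero key
  rw [discrim] at hd
  rw [e1, mul_pow]
  gcongr
  nlinarith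

theorem momentTr_add_rankOne (hb : MemLp b 2 μ) (s : ℝ) (z : D) :
    momentTr μ b (R₁ - s • rankOne ℂ (R₁ (b z)) (R₁ (b z))) =
      momentTr μ b R₁ - s * resolventDecay μ b R₁ z := by
  rw [momentTr_sub hb, momentTr_smul, momentTr_rankOne hb, resolventDecay]

end Resolvent

/-! ### One step of each barrier -/

section Steps

variable {D : Type*} [MeasurableSpace D] {μ : Measure D}
  {E : Type*} [NormedAddCommGroup E] [InnerProductSpace ℂ E] {b : D → E}
  {W R : E →L[ℂ] E} {δ ε : ℝ}

theorem isPositive_sub_of_le {S T : E →L[ℂ] E} (hS : S.IsPositive) (hT : T.IsPositive)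
    (h : ∀ v, (inner ℂ v (S v)).re ≤ (inner ℂ v (T v)).re) : (T - S).IsPositive := by
  rw [ContinuousLinearMap.isPositive_def]
  refine ⟨hT.isSymmetric.sub hS.isSymmetric, fun v => ?_⟩
  rw [ContinuousLinearMap.reApplyInnerSelf_apply, sub_apply, inner_sub_left,
    hS.inner_left_eq_inner_right, hT.inner_left_eq_inner_right]
  simpa using h v

theorem IsPosInv.inner_inv_le (h : IsPosInv W R) {c : ℝ} (hc : 0 < c)
    (hW : ∀ v, c * ‖v‖ ^ 2 ≤ (inner ℂ v (W v)).re) (v : E) :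
    (inner ℂ v (R v)).re ≤ c⁻¹ * ‖v‖ ^ 2 := by
  have h1 := hW (R v)
  rw [h.apply_inv] at h1
  have h2 : (inner ℂ (R v) v).re = (inner ℂ v (R v)).re := by
    rw [← inner_conj_symm, Complex.conj_re]
  have h3 : (inner ℂ v (R v)).re ≤ ‖v‖ * ‖R v‖ :=
    ((le_abs_self _).trans (Complex.abs_re_le_norm _)).trans (norm_inner_le_norm _ _)
  rw [h2] at h1
  rw [inv_mul_eq_div, le_div_iff₀ hc]
  set q := (inner ℂ v (R v)).re
  have h4 := norm_nonneg v
  have h5 := norm_nonneg (R v)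
  rcases (h5.eq_or_lt) with h6 | h6
  · rw [← h6, mul_zero] at h3
    nlinarith [sq_nonneg ‖v‖]
  · have h7 : c * ‖R v‖ ≤ ‖v‖ := by
      by_contra! h8
      nlinarith
    nlinarith

variable [CompleteSpace E]

theorem integral_resolventDecay_pos [Nontrivial E] (hb : MemLp b 2 μ)
    (hM : ∀ v ≠ 0, 0 < (inner ℂ v (momentOp μ b v)).re) (h : IsPosInv W R) :
    0 < ∫ z, resolventDecay μ b R z ∂μ := by
  refine lt_of_le_of_ne (integral_nonneg (resolventDecay_nonneg hb)) fun h0 => ?_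
  have h1 := (integral_eq_zero_iff_of_nonneg (resolventDecay_nonneg hb)
    (integrable_resolventDecay hb h)).1 h0.symm
  obtain ⟨v, hv⟩ := exists_ne (0 : E)
  have h2 := hM v hv
  rw [inner_momentOp_self_re hb, integral_eq_zero_of_ae] at h2
  · exact lt_irrefl _ h2
  · filter_upwards [h1] with z hz
    have h3 : R (b z) = 0 := by
      by_contra h4
      exact (hM _ h4).ne' hz
    have h5 := h.apply_inv (b z)
    rw [h3, map_zero] at h5
    simp [← h5]

/-- The shift by `δM` lowers the potential by some `Δ ≥ δQ`, where `Q` is the mean of the decay `q`.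
By Sherman-Morrison, subtracting `w b bᴴ` raises it by `w q / (1 - w β)`. This is at most `Δ` when
`w (q / Δ + β) ≤ 1`, which dictates `U`. -/
theorem upper_barrier_step [Nontrivial E] (hb : MemLp b 2 μ)
    (hM : ∀ v ≠ 0, 0 < (inner ℂ v (momentOp μ b v)).re) (hb0 : ∀ x, b x ≠ 0)
    (h : IsPosInv W R) (hε : momentTr μ b R ≤ ε) (hδ : 0 < δ) (hδε : δ⁻¹ + ε ≤ 1) :
    ∃ U : D → ℝ, Integrable U μ ∧ (∀ x, 0 < U x) ∧ ∫ x, U x ∂μ ≤ 1 ∧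
      ∀ x w, 0 < w → U x * w ≤ 1 →
        ∃ R', IsPosInv (W + δ • momentOp μ b - w • rankOne ℂ (b x) (b x)) R' ∧
          momentTr μ b R' ≤ ε := by
  obtain ⟨R₁, h₁⟩ := h.exists_of_le (W' := W + δ • momentOp μ b) (by
    rw [add_sub_cancel_left]
    exact isPositive_real_smul (momentOp_isPositive hb) hδ.le)
  have hQ := integral_resolventDecay_pos hb hM h₁
  have hΔ := momentTr_sub_eq hb h h₁ rfl
  have hS := resolventConvexity_nonneg hb h h₁
  set Q := ∫ z, resolventDecay μ b R₁ z ∂μ with hQd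
  set Δ := momentTr μ b R - momentTr μ b R₁ with hΔd
  have hΔQ : δ * Q ≤ Δ := by rw [hΔ]; nlinarith [mul_nonneg (sq_nonneg δ) hS]
  have hΔ0 : 0 < Δ := (mul_pos hδ hQ).trans_le hΔQ
  have hq : ∀ x, 0 < resolventDecay μ b R₁ x := fun x => hM _ fun h0 => hb0 x (by
    rw [← h₁.apply_inv (b x), h0, map_zero])
  have hβ : ∀ x, 0 < (inner ℂ (b x) (R₁ (b x))).re := fun x => h₁.inner_inv_pos (hb0 x)
  refine ⟨fun x => resolventDecay μ b R₁ x / Δ + (inner ℂ (b x) (R₁ (b x))).re,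
    ((integrable_resolventDecay hb h₁).div_const _).add (integrable_inner_apply hb R₁),
    fun x => add_pos (div_pos (hq x) hΔ0) (hβ x), ?_, fun x w hw hU => ?_⟩
  · rw [integral_add ((integrable_resolventDecay hb h₁).div_const _)
      (integrable_inner_apply hb R₁), integral_div, ← hQd]
    have h1 : Q / Δ ≤ δ⁻¹ := by
      rw [div_le_iff₀ hΔ0, inv_mul_eq_div, le_div_iff₀ hδ]
      linarith
    have h2 : momentTr μ b R₁ ≤ ε := by linarith
    change Q / Δ + momentTr μ b R₁ ≤ 1
    linarith
  · set β := (inner ℂ (b x) (R₁ (b x))).re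
    set q := resolventDecay μ b R₁ x
    have h1 : w * q / Δ ≤ 1 + -w * β := by
      have : (q / Δ + β) * w = w * q / Δ + w * β := by ring
      linarith
    have h2 : 0 < 1 + -w * β := (div_pos (mul_pos hw (hq x)) hΔ0).trans_le h1
    refine ⟨R₁ - (-w / (1 + -w * β)) • rankOne ℂ (R₁ (b x)) (R₁ (b x)), ?_, ?_⟩
    · have := h₁.add_rankOne (b x) h2
      rwa [neg_smul, ← sub_eq_add_neg] at this
    · rw [momentTr_add_rankOne hb]
      have h3 : w * q / (1 + -w * β) ≤ Δ := by
        rw [div_le_iff₀ h2]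
        rw [div_le_iff₀ hΔ0] at h1
        linarith
      have h4 : -w / (1 + -w * β) * q = -(w * q / (1 + -w * β)) := by ring
      rw [h4]
      linarith

/-- Here the shift raises the potential by `Δ` and the rank-one term must win it back, so `L = q / Δ
- β`. The mean of `β` is now the raised potential, at most `ε + Δ`; the extra `Δ` is paid for by the
second-order term of the expansion. -/
theorem lower_barrier_step [Nontrivial E] (hb : MemLp b 2 μ) {N : E →L[ℂ] E}
    (hM : IsPosInv (momentOp μ b) N) (h : IsPosInv W R) (hε : momentTr μ b R ≤ ε)
    (hε0 : 0 < ε) (hδ : 0 < δ) (hδε : 1 ≤ δ⁻¹ - ε) :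
    ∃ L : D → ℝ, Integrable L μ ∧ 1 ≤ ∫ x, L x ∂μ ∧
      ∀ x w, 0 < w → 1 ≤ L x * w →
        ∃ R', IsPosInv (W - δ • momentOp μ b + w • rankOne ℂ (b x) (b x)) R' ∧
          momentTr μ b R' ≤ ε := by
  have hMpos := momentOp_isPositive hb
  have hM' : ∀ v ≠ 0, 0 < (inner ℂ v (momentOp μ b v)).re := fun v hv => by
    have h1 := hM.inner_inv_pos (u := momentOp μ b v) fun h0 => hv (by
      rw [← hM.inv_apply v, h0, map_zero])
    rwa [hM.inv_apply, hMpos.inner_left_eq_inner_right] at h1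
  have hδε' : δ * ε ≤ 1 - δ := by
    have := mul_le_mul_of_nonneg_left hδε hδ.le
    rw [mul_sub, mul_inv_cancel₀ hδ.ne'] at this
    linarith
  have hc : 0 < ε⁻¹ - δ := by
    have : δ < ε⁻¹ := by
      rw [lt_inv_comm₀ hδ hε0]
      linarith
    linarith
  -- The potential bound gives `W ≥ ε⁻¹ M`, so the shifted barrier still dominates `(ε⁻¹ - δ) M`,
  -- which is invertible.
  obtain ⟨R₁, h₁⟩ := (hM.smul hc).exists_of_le (W' := W + (-δ) • momentOp μ b) (by
    have h1 : W + (-δ) • momentOp μ b - (ε⁻¹ - δ) • momentOp μ b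
      = W - ε⁻¹ • momentOp μ b := by module
    rw [h1]
    refine isPositive_sub_of_le (isPositive_real_smul hMpos (by positivity)) h.isPositive
      fun v => ?_
    have h2 := h.inner_momentOp_le hb hε v
    simp only [smul_apply, inner_smul_right_eq_smul, Complex.smul_re, smul_eq_mul]
    rwa [inv_mul_le_iff₀ hε0])
  have hΔ := momentTr_sub_eq hb h h₁ rfl
  have hΔ2 := momentTr_sub_sq_le hb h h₁ rfl
  have hΔ3 := momentTr_sub_eq hb h₁ h (t := δ) (by module)
  have hQ' := integral_resolventDecay_pos hb hM' h
  have hS := resolventConvexity_nonneg hb h h₁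
  have hS' := resolventConvexity_nonneg hb h₁ h
  set Q := ∫ z, resolventDecay μ b R₁ z ∂μ with hQd
  set S := resolventConvexity μ b R R₁
  obtain ⟨Δ, hΔd⟩ : ∃ Δ, Δ = momentTr μ b R₁ - momentTr μ b R := ⟨_, rfl⟩
  rw [← hΔd] at hΔ3
  have hΔ0 : 0 < Δ := by
    rw [hΔ3]
    have := mul_pos hδ hQ'
    have := mul_nonneg (sq_nonneg δ) hS'
    linarith
  have e1 : Δ = δ * Q - δ ^ 2 * S := by linarith
  have e2 : Δ ^ 2 ≤ δ * S := by
    have h1 : Δ ^ 2 ≤ δ ^ 2 * (momentTr μ b R * S) := by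
      calc Δ ^ 2 = (momentTr μ b R - momentTr μ b R₁) ^ 2 := by rw [hΔd]; ring
        _ ≤ _ := hΔ2
        _ = _ := by ring
    have h2 : δ * momentTr μ b R ≤ 1 := by
      have := mul_le_mul_of_nonneg_left hε hδ.le
      linarith
    have h3 := mul_le_mul_of_nonneg_right h2 (mul_nonneg hδ.le hS)
    nlinarith
  refine ⟨fun x => resolventDecay μ b R₁ x / Δ - (inner ℂ (b x) (R₁ (b x))).re,
    ((integrable_resolventDecay hb h₁).div_const _).sub (integrable_inner_apply hb R₁),
    ?_, fun x w hw hL => ?_⟩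
  · rw [integral_sub ((integrable_resolventDecay hb h₁).div_const _)
      (integrable_inner_apply hb R₁), integral_div, ← hQd]
    -- By `e1`, `Q = Δ / δ + δ S`, and `e2` says `δ S ≥ Δ²`.
    have h1 : δ⁻¹ + Δ ≤ Q / Δ := by
      rw [le_div_iff₀ hΔ0]
      have : δ⁻¹ * Δ = Q - δ * S := by rw [e1]; field_simp
      nlinarith
    change 1 ≤ Q / Δ - momentTr μ b R₁
    linarith
  · set β := (inner ℂ (b x) (R₁ (b x))).re with hβd
    set q := resolventDecay μ b R₁ x
    have hβ : 0 ≤ β := h₁.inv_isPositive.re_inner_nonneg_right _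
    have h1 : 1 + w * β ≤ w * q / Δ := by
      have : (q / Δ - β) * w = w * q / Δ - w * β := by ring
      linarith
    have h2 : 0 < 1 + w * β := by positivity
    refine ⟨R₁ - (w / (1 + w * β)) • rankOne ℂ (R₁ (b x)) (R₁ (b x)), ?_, ?_⟩
    · have := h₁.add_rankOne (b x) h2
      rwa [neg_smul, ← sub_eq_add_neg] at this
    · rw [momentTr_add_rankOne hb]
      have h3 : Δ ≤ w / (1 + w * β) * q := by
        rw [div_mul_eq_mul_div, le_div_iff₀ h2]
        rwa [le_div_iff₀ hΔ0, mul_comm] at h1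
      linarith

end Steps

/-! ### Greedy selection and the choice of barrier parameters -/

section Rules

variable {D : Type*} [MeasurableSpace D] {μ : Measure D}

/-- A condition on weighted point lists of length `n` which can be maintained by a greedy choice,
as long as the inverse weight of each new point is above a function of mean at most `1`. -/
def UpperRule (μ : Measure D) (n : ℕ) (C : List (D × ℝ) → Prop) : Prop :=
  ∃ P : ℕ → List (D × ℝ) → Prop, P 0 [] ∧ (∀ l, P n l → C l) ∧
    ∀ k l, P k l → ∃ U : D → ℝ, Integrable U μ ∧ (∀ x, 0 < U x) ∧ ∫ x, U x ∂μ ≤ 1 ∧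
      ∀ x w, 0 < w → U x * w ≤ 1 → P (k + 1) ((x, w) :: l)

/-- A condition on weighted point lists of length `n` which can be maintained by a greedy choice,
as long as the inverse weight of each new point is below a function of mean at least `1`. -/
def LowerRule (μ : Measure D) (n : ℕ) (C : List (D × ℝ) → Prop) : Prop :=
  ∃ P : ℕ → List (D × ℝ) → Prop, P 0 [] ∧ (∀ l, P n l → C l) ∧
    ∀ k l, P k l → ∃ L : D → ℝ, Integrable L μ ∧ 1 ≤ ∫ x, L x ∂μ ∧
      ∀ x w, 0 < w → 1 ≤ L x * w → P (k + 1) ((x, w) :: l)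

theorem UpperRule.exists_list [IsProbabilityMeasure μ] {n : ℕ} {C C' : List (D × ℝ) → Prop}
    (hU : UpperRule μ n C) (hL : LowerRule μ n C') :
    ∃ l : List (D × ℝ), l.length = n ∧ (∀ p ∈ l, 0 < p.2) ∧ C l ∧ C' l := by
  obtain ⟨P, hP0, hPn, hP⟩ := hU
  obtain ⟨P', hP0', hPn', hP'⟩ := hL
  have key : ∀ k, ∃ l : List (D × ℝ), l.length = k ∧ (∀ p ∈ l, 0 < p.2) ∧ P k l ∧ P' k l := by
    intro k
    induction k with
    | zero => exact ⟨[], rfl, by simp, hP0, hP0'⟩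
    | succ k ih =>
      obtain ⟨l, hl, hpos, h1, h2⟩ := ih
      obtain ⟨U, hUi, hU0, hU1, hUP⟩ := hP k l h1
      obtain ⟨L, hLi, hL1, hLP⟩ := hP' k l h2
      obtain ⟨x, hx⟩ := exists_integral_le (hLi.sub hUi)
      have hx' : U x ≤ L x := by
        have : ∫ a, (L - U) a ∂μ = ∫ a, L a ∂μ - ∫ a, U a ∂μ := integral_sub hLi hUi
        rw [this] at hx
        simp only [Pi.sub_apply] at hx
        linarith
      have hw : 0 < (U x)⁻¹ := inv_pos.2 (hU0 x)
      refine ⟨(x, (U x)⁻¹) :: l, by simp [hl], ?_, hUP x _ hw ?_, hLP x _ hw ?_⟩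
      · simpa [hU0 x] using fun a b hab => hpos (a, b) hab
      · rw [mul_inv_cancel₀ (hU0 x).ne']
      · rw [← div_eq_mul_inv, one_le_div (hU0 x)]
        exact hx'
  obtain ⟨l, h0, h1, h2, h3⟩ := key n
  exact ⟨l, h0, h1, hPn l h2, hPn' l h3⟩

variable {E : Type*} [NormedAddCommGroup E] [InnerProductSpace ℂ E] {b : D → E}

/-- The weighted sum of `|⟪b x, v⟫|²` over a list of weighted points. -/
def frameSum (b : D → E) (l : List (D × ℝ)) (v : E) : ℝ :=
  (l.map fun p => p.2 * ‖inner ℂ (b p.1) v‖ ^ 2).sum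

/-- The frame operator of a list of weighted points. -/
def frameOp (b : D → E) (l : List (D × ℝ)) : E →L[ℂ] E :=
  (l.map fun p => p.2 • rankOne ℂ (b p.1) (b p.1)).sum

theorem inner_frameOp_self_re {D : Type*} (b : D → E) (l : List (D × ℝ)) (v : E) :
    (inner ℂ v (frameOp b l v)).re = frameSum b l v := by
  induction l with
  | nil => simp [frameOp, frameSum]
  | cons p l ih =>
    simp only [frameOp, frameSum, List.map_cons, List.sum_cons] at ih ⊢
    rw [add_apply, inner_add_right, Complex.add_re, ih, smul_apply, rankOne_apply,
      inner_smul_right_eq_smul, Complex.smul_re, inner_smul_right, ← inner_conj_symm v (b p.1),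
      Complex.mul_conj']
    norm_cast

/-- In dimension one the barrier parameter `ε` would degenerate to `0`. There the frame bound is a
scalar inequality and can be accumulated directly, each step gaining one copy of `M`. -/
theorem lowerRule_of_span_singleton (hb : MemLp b 2 μ) [CompleteSpace E] (n : ℕ) {g : E}
    (hg : 0 < (inner ℂ g (momentOp μ b g)).re) (hspan : ∀ v, ∃ c : ℂ, v = c • g) :
    LowerRule μ n fun l => ∀ v, n * (inner ℂ v (momentOp μ b v)).re ≤ frameSum b l v := by
  refine ⟨fun k l => ∀ v, k * (inner ℂ v (momentOp μ b v)).re ≤ frameSum b l v, ?_,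
    fun l hl => hl, fun k l hl => ?_⟩
  · simp [frameSum]
  · refine ⟨fun x => ‖inner ℂ (b x) g‖ ^ 2 / (inner ℂ g (momentOp μ b g)).re,
      (integrable_norm_inner_sq hb g).div_const _, ?_, fun x w hw h v => ?_⟩
    · rw [integral_div, ← inner_momentOp_self_re hb, div_self hg.ne']
    · have h1 : (inner ℂ v (momentOp μ b v)).re ≤ w * ‖inner ℂ (b x) v‖ ^ 2 := by
        obtain ⟨c, rfl⟩ := hspan v
        have h2 : (inner ℂ (c • g) (momentOp μ b (c • g))).re
            = ‖c‖ ^ 2 * (inner ℂ g (momentOp μ b g)).re := by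
          simp only [inner_momentOp_self_re hb, inner_smul_right, norm_mul, mul_pow,
            integral_const_mul]
        rw [h2, inner_smul_right, norm_mul, mul_pow]
        rw [div_mul_eq_mul_div, le_div_iff₀ hg, one_mul] at h
        nlinarith [sq_nonneg ‖c‖]
      have h3 := hl v
      simp only [frameSum, List.map_cons, List.sum_cons] at h3 ⊢
      push_cast
      linarith

theorem lowerRule_of_isPosInv [Nontrivial E] [CompleteSpace E] (hb : MemLp b 2 μ)
    {N : E →L[ℂ] E} (hM : IsPosInv (momentOp μ b) N) {m : ℝ} (hm : 1 < m)
    (hN : momentTr μ b N = m) {n : ℕ} (hmn : m - 1 < n) :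
    LowerRule μ n fun l => ∀ v, (√n - √(m - 1)) ^ 2 * (inner ℂ v (momentOp μ b v)).re
      ≤ frameSum b l v := by
  have hs : 0 < √(m - 1) := Real.sqrt_pos.2 (by linarith)
  have hns : √(m - 1) < √n := Real.sqrt_lt_sqrt (by linarith) hmn
  have hs2 : √(m - 1) ^ 2 = m - 1 := Real.sq_sqrt (by linarith)
  have hn2 : √(n : ℝ) ^ 2 = n := Real.sq_sqrt (by positivity)
  set s := √(m - 1)
  set r := √(n : ℝ)
  -- These values make `δ⁻¹ - ε = 1` and `n δ - (m - 1) / ε = (r - s)²`. The initial barrier `(m /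
  -- ε) M` has potential exactly `ε`, because tr(`M N`) is `m`.
  obtain ⟨ε, hε⟩ : ∃ ε, ε = s / (r - s) := ⟨_, rfl⟩
  obtain ⟨δ, hδ⟩ : ∃ δ, δ = (r - s) / r := ⟨_, rfl⟩
  have hrs : 0 < r - s := by linarith
  have hr : 0 < r := by linarith
  have hε0 : 0 < ε := by rw [hε]; positivity
  have hδ0 : 0 < δ := by rw [hδ]; positivity
  have hδε : 1 ≤ δ⁻¹ - ε := by
    rw [hδ, hε]
    apply le_of_eq
    field_simp
  refine ⟨fun k l => ∃ R, IsPosInv (frameOp b l - (k * δ - m / ε) • momentOp μ b) R ∧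
    momentTr μ b R ≤ ε, ?_, fun l hl v => ?_, fun k l hl => ?_⟩
  · have hmε : 0 < m / ε := by positivity
    refine ⟨(m / ε)⁻¹ • N, ?_, ?_⟩
    · convert hM.smul hmε using 1
      simp [frameOp]
    · rw [momentTr_smul, hN, inv_div, div_mul_cancel₀ _ (by linarith : m ≠ 0)]
  · obtain ⟨R, hR, hRε⟩ := hl
    have h1 := hR.inner_momentOp_le hb hRε v
    simp only [sub_apply, smul_apply, inner_sub_right, inner_smul_right_eq_smul, Complex.sub_re,
      Complex.smul_re, smul_eq_mul, inner_frameOp_self_re] at h1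
    have h2 : (r - s) ^ 2 = n * δ - (m - 1) / ε := by
      rw [hδ, hε, ← hs2, ← hn2]
      field_simp
    rw [h2]
    -- The final estimate `M ≤ ε W` contributes an extra `M / ε`; this is what improves `m` to `m -
    -- 1`.
    have h3 : n * δ - (m - 1) / ε = (n * δ - m / ε) + 1 / ε := by ring
    rw [h3, add_mul, one_div, inv_mul_eq_div]
    have h4 := (div_le_iff₀' hε0).2 h1
    linarith
  · obtain ⟨R, hR, hRε⟩ := hl
    obtain ⟨L, hLi, hL1, hL⟩ := lower_barrier_step hb hM hR hRε hε0 hδ0 hδε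
    refine ⟨L, hLi, hL1, fun x w hw h => ?_⟩
    obtain ⟨R', hR', hRε'⟩ := hL x w hw h
    refine ⟨R', ?_, hRε'⟩
    convert hR' using 1
    simp only [frameOp, List.map_cons, List.sum_cons]
    push_cast
    module

/-- The barrier ends at `X + ε⁻¹ M - F`, with `F` the frame operator, so `M ≤ ε W` cancels the `M`
term and leaves `F ≤ X`. Because `M ≤ 1`, the initial barrier is at least `(1 + τ) / ε`. Its
potential is then at most `ε`, since `M` has trace `1 + τ`. -/
theorem upperRule_of_momentOp_le [Nontrivial E] [CompleteSpace E] (hb : MemLp b 2 μ)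
    (hM : ∀ v ≠ 0, 0 < (inner ℂ v (momentOp μ b v)).re)
    (hM1 : ∀ v, (inner ℂ v (momentOp μ b v)).re ≤ ‖v‖ ^ 2) (hb0 : ∀ x, b x ≠ 0)
    {τ : ℝ} (hτ : ∫ x, ‖b x‖ ^ 2 ∂μ = 1 + τ) {n : ℕ} (hn : 1 ≤ n * τ) :
    UpperRule μ n fun l => ∀ v, frameSum b l v ≤ (√n + √τ) ^ 2 * ‖v‖ ^ 2 := by
  have hn0 : (0 : ℝ) < n := by
    rcases Nat.eq_zero_or_pos n with h | h
    · rw [h] at hn; norm_num at hn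
    · exact_mod_cast h
  have hτ0 : 0 < τ := pos_of_mul_pos_right (zero_lt_one.trans_le hn) hn0.le
  have hs : 0 < √τ := Real.sqrt_pos.2 hτ0
  have hr : 0 < √(n : ℝ) := Real.sqrt_pos.2 hn0
  have hs2 : √τ ^ 2 = τ := Real.sq_sqrt hτ0.le
  have hn2 : √(n : ℝ) ^ 2 = n := Real.sq_sqrt hn0.le
  have hrs1 : 1 ≤ √(n : ℝ) * √τ := by
    rw [← Real.sqrt_mul hn0.le]
    exact Real.one_le_sqrt.2 hn
  set s := √τ
  set r := √(n : ℝ)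
  obtain ⟨ε, hε⟩ : ∃ ε, ε = s / (r + s) := ⟨_, rfl⟩
  obtain ⟨δ, hδ⟩ : ∃ δ, δ = (r + s) / r := ⟨_, rfl⟩
  have hε0 : 0 < ε := by rw [hε]; positivity
  have hδ0 : 0 < δ := by rw [hδ]; positivity
  have hδε : δ⁻¹ + ε ≤ 1 := by
    rw [hδ, hε]
    apply le_of_eq
    field_simp
  have hX : (r + s) ^ 2 = n * δ + τ / ε := by
    rw [hδ, hε, ← hs2, ← hn2]
    field_simp
  set X := (r + s) ^ 2
  -- This sign lets `M ≤ 1` be used on the initial barrier; it amounts to `r * s ≥ 1`, that is, to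
  -- `hn`.
  have hc : 0 ≤ n * δ - ε⁻¹ := by
    have : n * δ - ε⁻¹ = (r + s) * (r * s - 1) / s := by
      rw [hδ, hε, ← hn2]
      field_simp
    rw [this]
    exact div_nonneg (mul_nonneg (by positivity) (by linarith)) hs.le
  refine ⟨fun k l => ∃ R, IsPosInv (X • 1 - ((n - k) * δ - ε⁻¹) • momentOp μ b - frameOp b l) R ∧
    momentTr μ b R ≤ ε, ?_, fun l hl v => ?_, fun k l hl => ?_⟩
  · have hT : 0 < (1 + τ) / ε := by positivity
    have h1 : ∀ v, (inner ℂ v (momentOp μ b v)).re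
        ≤ (inner ℂ v ((1 : E →L[ℂ] E) v)).re := fun v => by
      refine (hM1 v).trans_eq ?_
      rw [one_apply_eq_self, inner_self_eq_norm_sq_to_K]
      norm_cast
    have h2 := isPositive_sub_of_le (momentOp_isPositive hb)
      ContinuousLinearMap.isPositive_one h1
    have h3 : X • (1 : E →L[ℂ] E) - ((n - (0 : ℕ)) * δ - ε⁻¹) • momentOp μ b - frameOp b []
        = ((1 + τ) / ε) • 1 + (n * δ - ε⁻¹) • (1 - momentOp μ b) := by
      have h4 : X = (1 + τ) / ε + (n * δ - ε⁻¹) := by rw [hX]; ring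
      rw [h4]
      simp only [frameOp, List.map_nil, List.sum_nil, Nat.cast_zero, sub_zero]
      module
    beta_reduce
    rw [h3]
    have h5 := isPositive_real_smul h2 hc
    obtain ⟨R, hR⟩ := (isPosInv_one.smul hT).exists_of_le
      (W' := ((1 + τ) / ε) • 1 + (n * δ - ε⁻¹) • (1 - momentOp μ b)) (by
        rwa [add_sub_cancel_left])
    refine ⟨R, hR, ?_⟩
    have h6 := momentTr_le_of_forall hb (hR.inner_inv_le hT fun v => by
      have h7 : 0 ≤ (inner ℂ v (((n * δ - ε⁻¹) • (1 - momentOp μ b)) v)).re :=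
        h5.re_inner_nonneg_right v
      have h8 : (inner ℂ v v).re = ‖v‖ ^ 2 := by
        rw [inner_self_eq_norm_sq_to_K]
        norm_cast
      rw [add_apply, inner_add_right, Complex.add_re, smul_apply, one_apply_eq_self,
        inner_smul_right_eq_smul, Complex.smul_re, h8, smul_eq_mul]
      linarith)
    rwa [hτ, inv_div, div_mul_cancel₀ _ (by linarith : 1 + τ ≠ 0)] at h6
  · obtain ⟨R, hR, hRε⟩ := hl
    have h1 := hR.inner_momentOp_le hb hRε v
    have h8 : (inner ℂ v v).re = ‖v‖ ^ 2 := by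
      rw [inner_self_eq_norm_sq_to_K]
      norm_cast
    simp only [sub_self, zero_mul, zero_sub, sub_apply, smul_apply, neg_smul, neg_apply,
      inner_neg_right, inner_sub_right, one_apply_eq_self,
      inner_smul_right_eq_smul, Complex.sub_re, Complex.neg_re,
      Complex.smul_re, smul_eq_mul, inner_frameOp_self_re, h8] at h1
    have h2 := (div_le_iff₀' hε0).2 h1
    rw [div_eq_inv_mul] at h2
    linarith
  · obtain ⟨R, hR, hRε⟩ := hl
    obtain ⟨U, hUi, hU0, hU1, hU⟩ := upper_barrier_step hb hM hb0 hR hRε hδ0 hδε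
    refine ⟨U, hUi, hU0, hU1, fun x w hw h => ?_⟩
    obtain ⟨R', hR', hRε'⟩ := hU x w hw h
    refine ⟨R', ?_, hRε'⟩
    convert hR' using 1
    simp only [frameOp, List.map_cons, List.sum_cons]
    push_cast
    module

end Rules

/-! ### Kernel sections as a square-integrable Hilbert space valued map -/

section RKHSFacts

variable {D : Type*} (H : Type*) [NormedAddCommGroup H] [InnerProductSpace ℂ H]
  [CompleteSpace H] [RKHS ℂ H D ℂ]

/-- The representer `K(x, ·)` of the evaluation at `x`. -/
def kerVec (x : D) : H := RKHS.kerFun H x (1 : ℂ)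

variable {H}

theorem kerVec_inner (x : D) (f : H) : inner ℂ (kerVec H x) f = f x := by
  rw [kerVec, RKHS.kerFun_inner]
  simp

theorem K_self_re (x : D) : (K H x x).re = ‖kerVec H x‖ ^ 2 := by
  have h : K H x x = inner ℂ (kerVec H x) (kerVec H x) := (kerVec_inner x _).symm
  rw [h, inner_self_eq_norm_sq_to_K]
  norm_cast

theorem kerVec_submodule (U : Submodule ℂ H) [CompleteSpace U] (x : D) :
    kerVec U x = U.orthogonalProjectionOnto (kerVec H x) := by
  refine ext_inner_right ℂ fun u => ?_
  rw [kerVec_inner, Submodule.inner_orthogonalProjectionOnto_eq_of_mem_right, kerVec_inner]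
  rfl

variable [MeasurableSpace D] {μ : Measure D}

theorem lpNorm_two_sq {f : D → ℂ} (hf : MemLp f 2 μ) :
    (lpNorm f 2 μ) ^ 2 = ∫ x, ‖f x‖ ^ 2 ∂μ := by
  rw [lpNorm_eq_integral_norm_rpow_toReal (by norm_num) (by norm_num) hf.1]
  have h0 : 0 ≤ ∫ x, ‖f x‖ ^ 2 ∂μ := integral_nonneg fun x => by positivity
  simp only [ENNReal.toReal_ofNat, Real.rpow_two]
  rw [← Real.rpow_two, ← Real.rpow_mul h0]
  norm_num

/-- By Bessel, the squared `L₂` norms of an orthonormal basis sum to at most the trace. Injectivity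
makes every term nonzero, so the basis is countable, and the expansion of `K(x, ·)` is a limit of
measurable finite sums. -/
theorem Admissible.aestronglyMeasurable_kerVec (hH : Admissible H μ) :
    AEStronglyMeasurable (kerVec H : D → H) μ := by
  obtain ⟨ι, b, -⟩ := exists_hilbertBasis ℂ H
  have hsum : Summable fun i => lpNorm (⇑(b i)) 2 μ ^ 2 := by
    refine summable_of_sum_le (c := traceK H μ) (fun i => by positivity) fun s => ?_
    calc ∑ i ∈ s, lpNorm (⇑(b i)) 2 μ ^ 2 = ∑ i ∈ s, ∫ x, ‖b i x‖ ^ 2 ∂μ :=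
          Finset.sum_congr rfl fun i _ => lpNorm_two_sq (hH.memLp (b i))
      _ = ∫ x, ∑ i ∈ s, ‖b i x‖ ^ 2 ∂μ :=
          (integral_finsetSum _ fun i _ => integrable_norm_sq (hH.memLp (b i))).symm
      _ ≤ traceK H μ := by
          refine integral_mono (integrable_finsetSum _ fun i _ =>
            integrable_norm_sq (hH.memLp (b i))) hH.finiteTrace fun x => ?_
          beta_reduce
          rw [K_self_re]
          refine le_trans (le_of_eq ?_) (b.orthonormal.sum_inner_products_le (kerVec H x) (s := s))
          refine Finset.sum_congr rfl fun i _ => ?_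
          rw [norm_inner_symm, kerVec_inner]
  have hc : Countable ι := by
    have h1 := hsum.countable_support
    have h2 : Function.support (fun i => lpNorm (⇑(b i)) 2 μ ^ 2) = Set.univ := by
      ext i
      simpa using hH.injective (b i) (b.orthonormal.ne_zero i)
    rw [h2] at h1
    exact Set.countable_univ_iff.1 h1
  refine aestronglyMeasurable_of_tendsto_ae (Filter.atTop : Filter (Finset ι))
    (f := fun s x => ∑ i ∈ s, inner ℂ (b i) (kerVec H x) • b i) (fun s => ?_)
    (ae_of_all _ fun x => ?_)
  · refine Finset.aestronglyMeasurable_fun_sum _ fun i _ => ?_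
    refine AEStronglyMeasurable.smul_const ?_ _
    have h3 : (fun x => inner ℂ (b i) (kerVec H x)) = fun x => star (b i x) := by
      ext x
      rw [← inner_conj_symm, kerVec_inner]
      rfl
    rw [h3]
    exact (hH.memLp (b i)).1.star
  · have h4 := b.hasSum_repr (kerVec H x)
    simp only [b.repr_apply_apply] at h4
    exact h4

theorem Admissible.memLp_kerVec (hH : Admissible H μ) : MemLp (kerVec H : D → H) 2 μ := by
  rw [memLp_two_iff_integrable_sq_norm hH.aestronglyMeasurable_kerVec]
  simpa only [K_self_re] using hH.finiteTrace

theorem Admissible.lpNorm_sq_eq (hH : Admissible H μ) (f : H) :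
    (lpNorm (⇑f) 2 μ) ^ 2 = (inner ℂ f (momentOp μ (kerVec H) f)).re := by
  rw [inner_momentOp_self_re hH.memLp_kerVec, lpNorm_two_sq (hH.memLp f)]
  simp only [kerVec_inner]

theorem Admissible.inner_momentOp_pos (hH : Admissible H μ) (f : H) (hf : f ≠ 0) :
    0 < (inner ℂ f (momentOp μ (kerVec H) f)).re := by
  rw [← hH.lpNorm_sq_eq]
  have := hH.injective f hf
  positivity

theorem Admissible.submodule (hH : Admissible H μ) (U : Submodule ℂ H) [CompleteSpace U] :
    Admissible U μ where
  memLp f := hH.memLp (f : H)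
  continuous := hH.continuous.mono (by
    rintro _ ⟨f, rfl⟩
    exact ⟨(f : H), rfl⟩)
  injective f hf := hH.injective (f : H) (by simpa using hf)
  finiteTrace := by
    simp only [K_self_re, kerVec_submodule]
    exact integrable_norm_sq (U.orthogonalProjectionOnto.comp_memLp' hH.memLp_kerVec)

theorem embConst_nonneg (H : Type*) [NormedAddCommGroup H] [InnerProductSpace ℂ H]
    [RKHS ℂ H D ℂ] : 0 ≤ embConst H μ :=
  Real.iSup_nonneg fun f => by positivity

theorem Admissible.lpNorm_sq_le (hH : Admissible H μ) (f : H) :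
    (lpNorm (⇑f) 2 μ) ^ 2 ≤ embConst H μ * ‖f‖ ^ 2 := by
  rcases eq_or_ne f 0 with rfl | hf
  · simp
  · have h := le_ciSup hH.continuous f
    rwa [div_le_iff₀ (by positivity)] at h

theorem Admissible.embConst_pos [Nontrivial H] (hH : Admissible H μ) : 0 < embConst H μ := by
  obtain ⟨f, hf⟩ := exists_ne (0 : H)
  have h := le_ciSup hH.continuous f
  have h1 := hH.injective f hf
  exact lt_of_lt_of_le (by positivity) h

theorem traceK_eq : traceK H μ = ∫ x, ‖kerVec H x‖ ^ 2 ∂μ := by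
  simp only [traceK, K_self_re]

theorem Admissible.embConst_le_traceK (hH : Admissible H μ) : embConst H μ ≤ traceK H μ := by
  refine ciSup_le fun f => ?_
  rcases eq_or_ne f 0 with rfl | hf
  · rw [norm_zero, traceK_eq]
    have h : 0 ≤ ∫ x, ‖kerVec H x‖ ^ 2 ∂μ := integral_nonneg fun x => by positivity
    simpa using h
  · rw [div_le_iff₀ (by positivity), lpNorm_two_sq (hH.memLp f), traceK_eq, ← integral_mul_const]
    refine integral_mono (integrable_norm_sq (hH.memLp f))
      ((integrable_norm_sq hH.memLp_kerVec).mul_const _) fun x => ?_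
    beta_reduce
    rw [← kerVec_inner, ← mul_pow]
    gcongr
    exact norm_inner_le_norm _ _

/-- The pointwise description of `h` identifies it with the Bochner integral of the kernel sections,
through which inner products pass. -/
theorem Admissible.integral_eq_inner [IsProbabilityMeasure μ] (hH : Admissible H μ) {h : H}
    (hh : ∀ y : D, h y = ∫ x, K H x y ∂μ) (f : H) : ∫ x, f x ∂μ = inner ℂ h f := by
  have hint : Integrable (kerVec H : D → H) μ := hH.memLp_kerVec.integrable (by norm_num)
  have h1 : h = ∫ x, kerVec H x ∂μ := by
    refine RKHS.ext fun y => ?_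
    rw [hh y, ← kerVec_inner y (∫ x, kerVec H x ∂μ), ← integral_inner hint]
    simp only [kerVec_inner]
    rfl
  rw [h1, ← inner_conj_symm, ← integral_inner hint, ← integral_conj]
  refine integral_congr_ae (ae_of_all _ fun x => ?_)
  simp only
  rw [inner_conj_symm, kerVec_inner]

end RKHSFacts

/-! ### The lower frame bound on a finite-dimensional space -/

section FiniteDimensional

variable {D : Type*} [MeasurableSpace D] {μ : Measure D}
  {E : Type*} [NormedAddCommGroup E] [InnerProductSpace ℂ E] [FiniteDimensional ℂ E]
  [CompleteSpace E] {b : D → E}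

theorem exists_isPosInv_momentOp (hb : MemLp b 2 μ)
    (hM : ∀ v ≠ 0, 0 < (inner ℂ v (momentOp μ b v)).re) : ∃ N, IsPosInv (momentOp μ b) N := by
  have hinj : Function.Injective (momentOp μ b : E →ₗ[ℂ] E) := by
    rw [← LinearMap.ker_eq_bot, LinearMap.ker_eq_bot']
    intro v hv
    by_contra h
    have h1 := hM v h
    have hv' : momentOp μ b v = 0 := hv
    simp [hv'] at h1
  let e := LinearEquiv.ofInjectiveEndo _ hinj
  exact ⟨LinearMap.toContinuousLinearMap (e.symm : E →ₗ[ℂ] E), momentOp_isPositive hb,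
    fun v => e.apply_symm_apply v, fun v => e.symm_apply_apply v⟩

theorem momentTr_inv (hb : MemLp b 2 μ) {N : E →L[ℂ] E} (hN : IsPosInv (momentOp μ b) N) :
    momentTr μ b N = Module.finrank ℂ E := by
  let e := stdOrthonormalBasis ℂ E
  have hint : ∀ u v : E, Integrable (fun x => inner ℂ u (b x) * inner ℂ (b x) v) μ := fun u v => by
    have h := ((integrable_rankOne hb).apply_continuousLinearMap v).const_inner (𝕜 := ℂ) u
    simpa only [rankOne_apply, inner_smul_right, mul_comm] using h
  have h1 : ∀ x, (inner ℂ (b x) (N (b x))).re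
      = ∑ j, (inner ℂ (N (e j)) (b x) * inner ℂ (b x) (e j)).re := fun x => by
    rw [← Complex.re_sum, ← e.sum_inner_mul_inner (b x) (N (b x))]
    congr 1
    refine Finset.sum_congr rfl fun j _ => ?_
    rw [hN.inv_isPositive.inner_left_eq_inner_right, mul_comm]
  have h2 : ∀ j, ∫ x, (inner ℂ (N (e j)) (b x) * inner ℂ (b x) (e j)).re ∂μ = 1 := fun j => by
    have h3 := integral_re (𝕜 := ℂ) (hint (N (e j)) (e j))
    rw [← inner_momentOp_eq_integral hb, hN.inv_isPositive.inner_left_eq_inner_right,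
      hN.inv_apply] at h3
    refine h3.trans ?_
    simp
  simp only [momentTr, h1]
  have h4 : ∀ j, Integrable (fun x => (inner ℂ (N (e j)) (b x) * inner ℂ (b x) (e j)).re) μ :=
    fun j => (hint (N (e j)) (e j)).re
  rw [integral_finsetSum _ fun j _ => h4 j]
  rw [Finset.sum_congr rfl fun j _ => h2 j]
  simp

theorem lowerRule_finrank [Nontrivial E] (hb : MemLp b 2 μ)
    (hM : ∀ v ≠ 0, 0 < (inner ℂ v (momentOp μ b v)).re) {n : ℕ}
    (hn : Module.finrank ℂ E ≤ n) :
    LowerRule μ n fun l => ∀ v, (√n - √((Module.finrank ℂ E : ℝ) - 1)) ^ 2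
      * (inner ℂ v (momentOp μ b v)).re ≤ frameSum b l v := by
  obtain ⟨N, hN⟩ := exists_isPosInv_momentOp hb hM
  have hpos : 0 < Module.finrank ℂ E := Module.finrank_pos
  have hn' : (Module.finrank ℂ E : ℝ) ≤ n := by exact_mod_cast hn
  rcases (Nat.succ_le_of_lt hpos).eq_or_lt with h1 | h1
  · obtain ⟨g, hg, hspan⟩ := finrank_eq_one_iff'.1 h1.symm
    have h2 := lowerRule_of_span_singleton hb n (hM g hg) fun v => (hspan v).imp fun _ h => h.symm
    rw [← h1]
    simpa [Real.sq_sqrt (Nat.cast_nonneg (α := ℝ) n)] using h2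
  · exact lowerRule_of_isPosInv hb hN (by exact_mod_cast h1) (momentTr_inv hb hN) (by linarith)

end FiniteDimensional

/-! ### Adding the constants, and the resulting quadrature rule -/

section Augmented

variable {D : Type*} [MeasurableSpace D] {μ : Measure D} [IsProbabilityMeasure μ]
  {H : Type*} [NormedAddCommGroup H] [InnerProductSpace ℂ H] [CompleteSpace H] [RKHS ℂ H D ℂ]

/-- The representers of `(a, f) ↦ a + c * f x` on the Hilbert sum `ℂ ⊕ H`. -/
def augVec (H : Type*) [NormedAddCommGroup H] [InnerProductSpace ℂ H] [CompleteSpace H]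
    [RKHS ℂ H D ℂ] (c : ℝ) (x : D) : WithLp 2 (ℂ × H) :=
  WithLp.toLp 2 ((1 : ℂ), (c : ℂ) • kerVec H x)

theorem augVec_inner {D : Type*} {H : Type*} [NormedAddCommGroup H] [InnerProductSpace ℂ H]
    [CompleteSpace H] [RKHS ℂ H D ℂ] (c : ℝ) (x : D) (v : WithLp 2 (ℂ × H)) :
    inner ℂ (augVec H c x) v = v.fst + c * v.snd x := by
  rw [WithLp.prod_inner_apply]
  simp only [augVec, inner_smul_left, kerVec_inner]
  simp

theorem augVec_ne_zero {D : Type*} {H : Type*} [NormedAddCommGroup H] [InnerProductSpace ℂ H]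
    [CompleteSpace H] [RKHS ℂ H D ℂ] (c : ℝ) (x : D) : augVec H c x ≠ 0 := fun h => by
  have := congrArg WithLp.fst h
  simp [augVec] at this

theorem Admissible.memLp_augVec (hH : Admissible H μ) (c : ℝ) :
    MemLp (augVec H c : D → WithLp 2 (ℂ × H)) 2 μ := by
  let A : H →L[ℂ] WithLp 2 (ℂ × H) :=
    ((WithLp.prodContinuousLinearEquiv 2 ℂ ℂ H).symm : ℂ × H →L[ℂ] WithLp 2 (ℂ × H)) ∘L
      ContinuousLinearMap.inr ℂ ℂ H
  have h1 : MemLp (fun x : D => A ((c : ℂ) • kerVec H x)) 2 μ :=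
    A.comp_memLp' (hH.memLp_kerVec.const_smul (c : ℂ))
  have h2 := h1.add (memLp_const (WithLp.toLp 2 ((1 : ℂ), (0 : H))))
  convert h2 using 1
  ext x
  simp only [augVec, A, Pi.add_apply, ContinuousLinearMap.comp_apply, ContinuousLinearMap.inr_apply]
  change _ = WithLp.toLp 2 ((0 : ℂ), (c : ℂ) • kerVec H x) + WithLp.toLp 2 ((1 : ℂ), (0 : H))
  rw [← WithLp.toLp_add]
  simp

theorem Admissible.integral_norm_augVec_sq (hH : Admissible H μ) (c : ℝ) :
    ∫ x, ‖augVec H c x‖ ^ 2 ∂μ = 1 + c ^ 2 * traceK H μ := by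
  have h : ∀ x : D, ‖augVec H c x‖ ^ 2 = 1 + c ^ 2 * ‖kerVec H x‖ ^ 2 := fun x => by
    rw [WithLp.prod_norm_sq_eq_of_L2]
    simp [augVec, norm_smul, mul_pow]
  simp only [h, traceK_eq]
  rw [integral_add (integrable_const _) ((integrable_norm_sq hH.memLp_kerVec).const_mul _),
    integral_const_mul]
  simp

/-- The mean-zero hypothesis kills the cross term between the constant and the function. -/
theorem Admissible.inner_momentOp_augVec (hH : Admissible H μ)
    (h0 : ∀ f : H, ∫ x, f x ∂μ = 0) (c : ℝ) (v : WithLp 2 (ℂ × H)) :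
    (inner ℂ v (momentOp μ (augVec H c) v)).re =
      ‖v.fst‖ ^ 2 + c ^ 2 * lpNorm (⇑v.snd) 2 μ ^ 2 := by
  have hL := hH.memLp v.snd
  have hi : Integrable (⇑v.snd) μ := hL.integrable (by norm_num)
  have h1 : ∀ x : D, ‖v.fst + c * v.snd x‖ ^ 2
      = ‖v.fst‖ ^ 2 + c ^ 2 * ‖v.snd x‖ ^ 2
        + 2 * c * ((starRingEnd ℂ) v.fst * v.snd x).re := fun x => by
    simp only [Complex.sq_norm, Complex.normSq_apply, Complex.add_re, Complex.add_im,
      Complex.mul_re, Complex.mul_im, Complex.ofReal_re, Complex.ofReal_im, Complex.conj_re,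
      Complex.conj_im]
    ring
  have h2 : Integrable (fun x => ((starRingEnd ℂ) v.fst * v.snd x).re) μ :=
    (hi.const_mul _).re
  have h3 : ∫ x, ((starRingEnd ℂ) v.fst * v.snd x).re ∂μ = 0 := by
    have := integral_re (𝕜 := ℂ) (hi.const_mul ((starRingEnd ℂ) v.fst))
    refine this.trans ?_
    rw [integral_const_mul, h0]
    simp
  have h4 := (integrable_norm_sq hL).const_mul (c ^ 2)
  have h5 : Integrable (fun x => ‖v.fst‖ ^ 2 + c ^ 2 * ‖v.snd x‖ ^ 2) μ :=
    (integrable_const _).add h4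
  rw [inner_momentOp_self_re (hH.memLp_augVec c)]
  simp only [augVec_inner, h1]
  rw [integral_add h5 (h2.const_mul _), integral_const_mul, h3,
    integral_add (integrable_const _) h4, integral_const_mul, lpNorm_two_sq hL]
  simp

/-- With `c² = 1 / embConst` the augmented moment operator is at most `1` and has trace `1 + traceK
/ embConst`. Testing the frame bound on `(1, 0)` gives the total weight, on `(0, f)` the samples of
`f`. -/
theorem Admissible.upperRule [Nontrivial H] (hH : Admissible H μ)
    (h0 : ∀ f : H, ∫ x, f x ∂μ = 0) {n : ℕ} (hn : 1 ≤ n) :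
    UpperRule μ n fun l => (l.map fun p => p.2).sum
        ≤ (√n + √(traceK H μ / embConst H μ)) ^ 2 ∧
      ∀ f : H, frameSum (kerVec H) l f
        ≤ (√n + √(traceK H μ / embConst H μ)) ^ 2 * (embConst H μ * ‖f‖ ^ 2) := by
  have hΛ := hH.embConst_pos
  have hc2 : (√(embConst H μ))⁻¹ ^ 2 = (embConst H μ)⁻¹ := by
    rw [inv_pow, Real.sq_sqrt hΛ.le]
  have hc0 : (√(embConst H μ))⁻¹ ≠ 0 := (inv_pos.2 (Real.sqrt_pos.2 hΛ)).ne'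
  set c := (√(embConst H μ))⁻¹
  have hτ : ∫ x, ‖augVec H c x‖ ^ 2 ∂μ = 1 + traceK H μ / embConst H μ := by
    rw [hH.integral_norm_augVec_sq, hc2, inv_mul_eq_div]
  have hτ1 : 1 ≤ traceK H μ / embConst H μ := (one_le_div hΛ).2 hH.embConst_le_traceK
  have hn' : (1 : ℝ) ≤ n := by exact_mod_cast hn
  have key := upperRule_of_momentOp_le (hH.memLp_augVec c) (fun v hv => ?_) (fun v => ?_)
    (augVec_ne_zero c) hτ (n := n) (by nlinarith)
  · obtain ⟨P, hP0, hPn, hP⟩ := key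
    refine ⟨P, hP0, fun l hl => ?_, hP⟩
    have h1 := hPn l hl
    refine ⟨?_, fun f => ?_⟩
    · have h2 := h1 (WithLp.toLp 2 ((1 : ℂ), (0 : H)))
      rw [WithLp.prod_norm_sq_eq_of_L2] at h2
      simp only [frameSum, augVec_inner] at h2
      simpa using h2
    · have h2 := h1 (WithLp.toLp 2 ((0 : ℂ), f))
      rw [WithLp.prod_norm_sq_eq_of_L2] at h2
      have h3 : frameSum (augVec H c) l (WithLp.toLp 2 ((0 : ℂ), f))
          = (embConst H μ)⁻¹ * frameSum (kerVec H) l f := by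
        simp only [frameSum, augVec_inner, kerVec_inner, ← List.sum_map_mul_left]
        refine congrArg List.sum (List.map_congr_left fun p _ => ?_)
        change p.2 * ‖(0 : ℂ) + c * f p.1‖ ^ 2 = _
        simp only [zero_add, norm_mul, mul_pow, Complex.norm_real, Real.norm_eq_abs, sq_abs, hc2]
        ring
      rw [h3, inv_mul_le_iff₀ hΛ] at h2
      refine h2.trans_eq ?_
      simp
      ring
  · rw [hH.inner_momentOp_augVec h0]
    rcases eq_or_ne v.snd 0 with h | h
    · have h1 : v.fst ≠ 0 := fun h2 => hv (WithLp.ofLp_injective 2 (Prod.ext h2 h))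
      positivity
    · have := hH.injective v.snd h
      positivity
  · rw [hH.inner_momentOp_augVec h0, WithLp.prod_norm_sq_eq_of_L2, hc2]
    gcongr
    rw [inv_mul_le_iff₀ hΛ]
    exact hH.lpNorm_sq_le v.snd

theorem upperRule_sum_le {D : Type*} [MeasurableSpace D] {μ : Measure D} [IsProbabilityMeasure μ]
    (n : ℕ) :
    UpperRule μ n fun l => (l.map fun p => p.2).sum ≤ n := by
  refine ⟨fun k l => (l.map fun p => p.2).sum ≤ k, by simp, fun l hl => hl, fun k l hl =>
    ⟨fun _ => 1, integrable_const _, fun _ => one_pos, by simp, fun x w _ h => ?_⟩⟩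
  simp only [List.map_cons, List.sum_cons]
  push_cast
  linarith

/-- A quadrature rule with positive weights which is simultaneously a lower frame on `V` and an
upper frame on the constants and on the orthogonal complement of `V`. -/
theorem Admissible.exists_quadrature (hH : Admissible H μ) (V : Submodule ℂ H)
    [FiniteDimensional ℂ V] (hV : 1 ≤ Module.finrank ℂ V)
    (hh : ∃ h ∈ V, ∀ y : D, h y = ∫ x, K H x y ∂μ) {n : ℕ} (hn : Module.finrank ℂ V ≤ n) :
    ∃ (x : Fin n → D) (w : Fin n → ℝ), (∀ i, 0 < w i) ∧
      (∀ g ∈ V, (1 - √(((Module.finrank ℂ V : ℝ) - 1) / n)) ^ 2 * lpNorm (⇑g) 2 μ ^ 2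
        ≤ ∑ i, w i * ‖g (x i)‖ ^ 2) ∧
      ∑ i, w i ≤ (1 + √(traceK Vᗮ μ / (n * embConst Vᗮ μ))) ^ 2 ∧
      ∀ f ∈ Vᗮ, ∑ i, w i * ‖f (x i)‖ ^ 2
        ≤ (1 + √(traceK Vᗮ μ / (n * embConst Vᗮ μ))) ^ 2 * (embConst Vᗮ μ * ‖f‖ ^ 2) := by
  have : CompleteSpace V := FiniteDimensional.complete ℂ V
  have : Nontrivial V := Module.nontrivial_of_finrank_pos hV
  have hn1 : 1 ≤ n := hV.trans hn
  have hn0 : (0 : ℝ) < n := by exact_mod_cast hn1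
  have hnn : √(n : ℝ) ≠ 0 := (Real.sqrt_pos.2 hn0).ne'
  have hn2 : √(n : ℝ) ^ 2 = n := Real.sq_sqrt hn0.le
  have hHV := hH.submodule V
  have hHV' := hH.submodule Vᗮ
  have h0 : ∀ f : Vᗮ, ∫ x, f x ∂μ = 0 := fun f => by
    obtain ⟨h, hhV, hh⟩ := hh
    exact (hH.integral_eq_inner hh (f : H)).trans (f.2 h hhV)
  set s := √(traceK Vᗮ μ / (n * embConst Vᗮ μ)) with hs
  have hU : UpperRule μ n fun l => (l.map fun p => p.2).sum ≤ n * (1 + s) ^ 2 ∧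
      ∀ f : Vᗮ, frameSum (kerVec Vᗮ) l f
        ≤ n * (1 + s) ^ 2 * (embConst Vᗮ μ * ‖f‖ ^ 2) := by
    -- If `Vᗮ` is zero there is no constant to normalize by; only the total weight matters, and `U =
    -- 1` controls it.
    rcases subsingleton_or_nontrivial Vᗮ with hsub | hnon
    · obtain ⟨P, hP0, hPn, hP⟩ := upperRule_sum_le (μ := μ) n
      refine ⟨P, hP0, fun l hl => ⟨(hPn l hl).trans ?_, fun f => ?_⟩, hP⟩
      · have : 0 ≤ s := Real.sqrt_nonneg _
        exact le_mul_of_one_le_right hn0.le (by nlinarith)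
      · rw [Subsingleton.elim f 0]
        simp [frameSum]
    · have h1 := hHV'.upperRule h0 hn1
      have h2 : (√n + √(traceK Vᗮ μ / embConst Vᗮ μ)) ^ 2 = n * (1 + s) ^ 2 := by
        have h3 : √(traceK Vᗮ μ / embConst Vᗮ μ) = √n * s := by
          rw [hs, ← Real.sqrt_mul hn0.le]
          congr 1
          have := hHV'.embConst_pos
          field_simp
        rw [h3, ← hn2]
        simp only [Real.sqrt_sq (Real.sqrt_nonneg _)]
        ring
      rwa [h2] at h1
  have hL := lowerRule_finrank hHV.memLp_kerVec hHV.inner_momentOp_pos hn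
  obtain ⟨l, hl, hpos, ⟨hw, hf⟩, hg⟩ := hU.exists_list hL
  subst hl
  have hsum : ∀ F : D × ℝ → ℝ, ∑ i : Fin l.length, F l[i] = (l.map F).sum :=
    fun F => Fin.sum_univ_fun_getElem l F
  refine ⟨fun i => l[i].1, fun i => l[i].2 / l.length,
    fun i => div_pos (hpos _ (List.getElem_mem _)) hn0, fun g hgV => ?_, ?_, fun f hfV => ?_⟩
  · have h1 := hg ⟨g, hgV⟩
    rw [← hHV.lpNorm_sq_eq, frameSum, ← hsum] at h1
    simp only [kerVec_inner, subspace_apply] at h1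
    have h2 : (√(l.length : ℝ) - √((Module.finrank ℂ V : ℝ) - 1)) ^ 2
        = l.length * (1 - √(((Module.finrank ℂ V : ℝ) - 1) / l.length)) ^ 2 := by
      rw [Real.sqrt_div' _ hn0.le]
      nth_rewrite 2 [← hn2]
      field_simp
    rw [h2, mul_assoc] at h1
    simp only [div_mul_eq_mul_div, ← Finset.sum_div]
    rw [le_div_iff₀' hn0]
    exact h1
  · rw [← Finset.sum_div, div_le_iff₀' hn0, hsum fun p => p.2]
    exact hw
  · have h1 := hf ⟨f, hfV⟩
    rw [frameSum, ← hsum] at h1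
    simp only [kerVec_inner, subspace_apply] at h1
    simp only [div_mul_eq_mul_div, ← Finset.sum_div]
    rw [div_le_iff₀' hn0, ← mul_assoc]
    exact h1

end Augmented

/-! ### Weighted least squares as an orthogonal projection -/

section LeastSquares

variable {D : Type*} {H : Type*} [NormedAddCommGroup H] [InnerProductSpace ℂ H] [RKHS ℂ H D ℂ]

/-- The weighted least squares problem on `V` is the orthogonal projection of the data onto the
weighted samples of `V`: it is uniquely solvable if sampling is injective on `V`, and the solution
is at least as close to the samples of any `g₀ ∈ V` as the data are. -/
theorem existsUnique_isWeightedLeastSquares (V : Submodule ℂ H) {n : ℕ} (x : Fin n → D)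
    {w : Fin n → ℝ} (hw : ∀ i, 0 < w i)
    (hinj : ∀ g ∈ V, ∑ i, w i * ‖g (x i)‖ ^ 2 = 0 → g = 0) (y : Fin n → ℂ) :
    (∃! g : H, IsWeightedLeastSquares V x w y g) ∧
      ∀ g : H, IsWeightedLeastSquares V x w y g → ∀ g₀ ∈ V,
        ∑ i, w i * ‖g (x i) - g₀ (x i)‖ ^ 2 ≤ ∑ i, w i * ‖y i - g₀ (x i)‖ ^ 2 := by
  let scale : (Fin n → ℂ) →ₗ[ℂ] EuclideanSpace ℂ (Fin n) :=
    { toFun := fun z => WithLp.toLp 2 fun i => ((√(w i) : ℝ) : ℂ) * z i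
      map_add' := fun z z' => by ext i; simp [mul_add]
      map_smul' := fun c z => by ext i; simp; ring }
  have hscale : ∀ z, ‖scale z‖ ^ 2 = ∑ i, w i * ‖z i‖ ^ 2 := fun z => by
    rw [EuclideanSpace.norm_sq_eq]
    refine Finset.sum_congr rfl fun i _ => ?_
    simp only [scale, LinearMap.coe_mk, AddHom.coe_mk, norm_mul, mul_pow, Complex.norm_real,
      Real.norm_eq_abs, sq_abs, Real.sq_sqrt (hw i).le]
  let samp : H →ₗ[ℂ] (Fin n → ℂ) :=
    { toFun := fun g i => g (x i)
      map_add' := fun g g' => by ext i; simp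
      map_smul' := fun c g => by ext i; simp }
  let S : Submodule ℂ (EuclideanSpace ℂ (Fin n)) := V.map (scale ∘ₗ samp)
  have hS : ∀ g ∈ V, scale (samp g) ∈ S := fun g hg => ⟨g, hg, rfl⟩
  obtain ⟨p, hp⟩ : ∃ p, p = S.starProjection (scale y) := ⟨_, rfl⟩
  have hpS : p ∈ S := hp ▸ S.starProjection_apply_mem _
  have hpyth : ∀ q ∈ S, ‖scale y - q‖ ^ 2 = ‖scale y - p‖ ^ 2 + ‖p - q‖ ^ 2 := fun q hq => by
    have h1 : inner ℂ (scale y - p) (p - q) = 0 := by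
      rw [hp]
      exact S.starProjection_inner_eq_zero _ _ (S.sub_mem (hp ▸ hpS) hq)
    have h2 := norm_add_sq_eq_norm_sq_add_norm_sq_of_inner_eq_zero _ _ h1
    rw [sub_add_sub_cancel] at h2
    simpa only [sq] using h2
  have hfun : ∀ z (g : H), ∑ i, w i * ‖z i - g (x i)‖ ^ 2 = ‖scale z - scale (samp g)‖ ^ 2 :=
    fun z g => by
      rw [← map_sub, hscale]
      rfl
  have hiff : ∀ g, IsWeightedLeastSquares V x w y g ↔ g ∈ V ∧ scale (samp g) = p := fun g => by
    simp only [IsWeightedLeastSquares, hfun]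
    refine and_congr_right fun hg => ⟨fun h => ?_, fun h g' hg' => ?_⟩
    · obtain ⟨g', hg', h2⟩ := hpS
      have h3 := h g' hg'
      have h4 : scale (samp g') = p := h2
      rw [h4, hpyth _ (hS g hg)] at h3
      have h5 : ‖p - scale (samp g)‖ = 0 := by
        have := sq_nonneg ‖p - scale (samp g)‖
        have h6 : ‖p - scale (samp g)‖ ^ 2 = 0 := by linarith
        simpa using h6
      exact (sub_eq_zero.1 (norm_eq_zero.1 h5)).symm
    · rw [h, hpyth _ (hS g' hg')]
      have := sq_nonneg ‖p - scale (samp g')‖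
      linarith
  refine ⟨?_, fun g hg g₀ hg₀ => ?_⟩
  · obtain ⟨g, hg, h2⟩ := hpS
    refine ⟨g, (hiff g).2 ⟨hg, h2⟩, fun g' hg' => ?_⟩
    obtain ⟨h3, h4⟩ := (hiff g').1 hg'
    refine sub_eq_zero.1 (hinj (g' - g) (V.sub_mem h3 hg) ?_)
    have h5 : scale (samp g) = p := h2
    have h6 : scale (samp (g' - g)) = 0 := by rw [map_sub, map_sub, h4, h5, sub_self]
    have h7 := hscale (samp (g' - g))
    rw [h6, norm_zero] at h7
    exact h7.symm.trans (by norm_num)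
  · obtain ⟨h3, h4⟩ := (hiff g).1 hg
    rw [hfun y, hpyth _ (hS g₀ hg₀), ← h4]
    have h5 := hfun (samp g) g₀
    have h6 := sq_nonneg ‖scale y - scale (samp g)‖
    have h7 : ∑ i, w i * ‖g (x i) - g₀ (x i)‖ ^ 2 = ‖scale (samp g) - scale (samp g₀)‖ ^ 2 := h5
    linarith

end LeastSquares

end NoisyRecovery

end

/-! ### The error bound -/

theorem corollary3p2 {D : Type*} [MeasurableSpace D] (μ : Measure D) [IsProbabilityMeasure μ]
    {H : Type*} [NormedAddCommGroup H] [InnerProductSpace ℂ H] [CompleteSpace H] [RKHS ℂ H D ℂ]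
    (hH : NoisyRecovery.Admissible H μ)
    (m : ℕ) (hm : 1 ≤ m) (V : Submodule ℂ H) [FiniteDimensional ℂ V]
    (hV : Module.finrank ℂ V = m)
    (hh : ∃ h ∈ V, ∀ y : D, h y = ∫ x, NoisyRecovery.K H x y ∂μ)
    (n : ℕ) (hmn : m ≤ n) :
    ∃ (x : Fin n → D) (w : Fin n → ℝ), (∀ i, 0 < w i) ∧
      ∀ (f : H) (e : Fin n → ℂ),
        (∃! g : H, NoisyRecovery.IsWeightedLeastSquares V x w (fun i => f (x i) + e i) g) ∧
        ∀ g : H, NoisyRecovery.IsWeightedLeastSquares V x w (fun i => f (x i) + e i) g →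
          lpNorm (⇑(f - g)) 2 μ ≤
            (1 + √(NoisyRecovery.traceK Vᗮ μ / (n * NoisyRecovery.embConst Vᗮ μ)))
              / (1 - √(((m : ℝ) - 1) / n))
            * (2 * √(NoisyRecovery.embConst Vᗮ μ) * ‖f - V.starProjection f‖ + ‖e‖) := by
  subst hV
  obtain ⟨x, w, hw, hg, hwsum, hf⟩ := hH.exists_quadrature V hm hh hmn
  have hm' : (1 : ℝ) ≤ Module.finrank ℂ V := by exact_mod_cast hm
  have hmn' : (Module.finrank ℂ V : ℝ) ≤ n := by exact_mod_cast hmn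
  have hr0 : 0 ≤ √(((Module.finrank ℂ V : ℝ) - 1) / n) := Real.sqrt_nonneg _
  have hr1 : √(((Module.finrank ℂ V : ℝ) - 1) / n) < 1 := by
    rw [Real.sqrt_lt' one_pos, one_pow, div_lt_one (by linarith)]
    linarith
  have hs0 : 0 ≤ √(NoisyRecovery.traceK Vᗮ μ / (n * NoisyRecovery.embConst Vᗮ μ)) :=
    Real.sqrt_nonneg _
  have hΛ0 : 0 ≤ NoisyRecovery.embConst Vᗮ μ := NoisyRecovery.embConst_nonneg _
  have hHV := hH.submodule Vᗮ
  have hemb : ∀ u ∈ Vᗮ, lpNorm (⇑u) 2 μ ^ 2 ≤ NoisyRecovery.embConst Vᗮ μ * ‖u‖ ^ 2 :=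
    fun u hu => hHV.lpNorm_sq_le ⟨u, hu⟩
  set r := √(((Module.finrank ℂ V : ℝ) - 1) / n)
  set s := √(NoisyRecovery.traceK Vᗮ μ / (n * NoisyRecovery.embConst Vᗮ μ))
  set Λ := NoisyRecovery.embConst Vᗮ μ
  have h1r : 0 < 1 - r := by linarith
  refine ⟨x, w, hw, fun f e => ?_⟩
  obtain ⟨hex, hle⟩ := NoisyRecovery.existsUnique_isWeightedLeastSquares V x hw
    (fun g hgV h0 => by
      have h1 := hg g hgV
      rw [h0] at h1
      by_contra h2
      have h3 := hH.injective g h2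
      have : 0 < (1 - r) ^ 2 * lpNorm (⇑g) 2 μ ^ 2 := by positivity
      linarith) (fun i => f (x i) + e i)
  refine ⟨hex, fun g hgls => ?_⟩
  have hPV : V.starProjection f ∈ V := V.starProjection_apply_mem f
  have huV : f - V.starProjection f ∈ Vᗮ := V.sub_starProjection_mem_orthogonal f
  have h1 := hle g hgls _ hPV
  set p := V.starProjection f
  set u := f - p with hu
  -- Relative to `p`, the data are the samples of `u` plus noise. Minkowski in the weighted `ℓ₂`
  -- norm separates them: the upper frame bound handles `u`, the total weight handles `e`.
  have hgap : (1 - r) * lpNorm (⇑(g - p)) 2 μ ≤ (1 + s) * (√Λ * ‖u‖ + ‖e‖) := by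
    have h2 := hg (g - p) (V.sub_mem hgls.1 hPV)
    have h3 := hf u huV
    have h4 : ∑ i, w i * ‖u (x i) + e i‖ ^ 2 ≤ ((1 + s) * (√Λ * ‖u‖ + ‖e‖)) ^ 2 := by
      let A : EuclideanSpace ℝ (Fin n) := WithLp.toLp 2 fun i => √(w i) * ‖u (x i)‖
      let B : EuclideanSpace ℝ (Fin n) := WithLp.toLp 2 fun i => √(w i) * ‖e i‖
      have hA : ‖A‖ ≤ (1 + s) * (√Λ * ‖u‖) := by
        refine abs_le_of_sq_le_sq' ?_ (by positivity) |>.2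
        rw [EuclideanSpace.real_norm_sq_eq]
        refine le_trans (le_of_eq ?_) (h3.trans_eq ?_)
        · refine Finset.sum_congr rfl fun i _ => ?_
          simp only [A, mul_pow, Real.sq_sqrt (hw i).le]
        · rw [mul_pow, mul_pow, Real.sq_sqrt hΛ0]
      have hB : ‖B‖ ≤ (1 + s) * ‖e‖ := by
        refine abs_le_of_sq_le_sq' ?_ (by positivity) |>.2
        rw [EuclideanSpace.real_norm_sq_eq, mul_pow]
        calc ∑ i, B i ^ 2 ≤ ∑ i, w i * ‖e‖ ^ 2 := by
              refine Finset.sum_le_sum fun i _ => ?_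
              simp only [B, mul_pow, Real.sq_sqrt (hw i).le]
              have := hw i
              gcongr
              exact norm_le_pi_norm e i
          _ = (∑ i, w i) * ‖e‖ ^ 2 := (Finset.sum_mul _ _ _).symm
          _ ≤ _ := by gcongr
      calc ∑ i, w i * ‖u (x i) + e i‖ ^ 2 ≤ ‖A + B‖ ^ 2 := by
            rw [EuclideanSpace.real_norm_sq_eq]
            refine Finset.sum_le_sum fun i _ => ?_
            have h5 : (A + B) i = √(w i) * (‖u (x i)‖ + ‖e i‖) := by simp [A, B, mul_add]
            rw [h5, mul_pow, Real.sq_sqrt (hw i).le]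
            have := hw i
            gcongr
            exact norm_add_le _ _
        _ ≤ _ := by
            gcongr
            rw [mul_add]
            exact (norm_add_le A B).trans (add_le_add hA hB)
    have h5 : ∑ i, w i * ‖(g - p) (x i)‖ ^ 2 ≤ ∑ i, w i * ‖u (x i) + e i‖ ^ 2 := by
      refine le_trans (le_of_eq ?_) (h1.trans_eq ?_)
      · simp only [RKHS.coe_sub, Pi.sub_apply]
      · simp only [hu, RKHS.coe_sub, Pi.sub_apply]
        refine Finset.sum_congr rfl fun i _ => ?_
        congr 3
        ring
    refine abs_le_of_sq_le_sq' ?_ (by positivity) |>.2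
    rw [mul_pow]
    exact h2.trans (h5.trans h4)
  have hu2 : lpNorm (⇑u) 2 μ ≤ √Λ * ‖u‖ := by
    refine abs_le_of_sq_le_sq' ?_ (by positivity) |>.2
    rw [mul_pow, Real.sq_sqrt hΛ0]
    exact hemb u huV
  have htri : lpNorm (⇑(f - g)) 2 μ ≤ lpNorm (⇑u) 2 μ + lpNorm (⇑(g - p)) 2 μ := by
    have h2 : ⇑(f - g) = ⇑u - ⇑(g - p) := by
      rw [← RKHS.coe_sub, hu]
      congr 1
      abel
    rw [h2]
    exact lpNorm_sub_le (hH.memLp u) (by norm_num)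
  rw [div_mul_eq_mul_div, le_div_iff₀ h1r]
  have h6 : 0 ≤ √Λ * ‖u‖ := by positivity
  -- The factor `2` arises because `‖u‖₂ ≤ √Λ ‖u‖` is added to the gap bound and `1 - r ≤ 1 + s`.
  nlinarith [mul_le_mul_of_nonneg_right htri h1r.le, mul_le_mul_of_nonneg_right hu2 h1r.le,
    mul_nonneg hr0 h6, mul_nonneg hs0 h6]
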